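/- All 2-categories are weak (bicategories), and linear means $\mathbb C$-linear. A \emph{fusion 2-category} is a finite semisimple monoidal bicategory (hom-categories finite semisimple, every 1-morphism with left and right adjoints, zero object and direct sums, every separable monad splits, finitely many simple objects up to equivalence) with bilinear tensor product, left and right duals for all objects, and simple unit object $\mathbb 1$. Let $\mathcal L$ be a fusion 2-category with a braiding, i.e. a natural adjoint equivalence $b_{x|y}\colon x\otimes y\to y\otimes x$ with invertible hexagonator modifications $R(x|y,z)$, $S(x,y|z)$ satisfying the usual axioms of a braided monoidal bicategory. The \emph{sylleptic centre} $\mathcal Z_{(2)}(\mathcal L)$ is the following bicategory. An object is a pair $(x,v_{x||-})$ of an object $x$ and an invertible modification $v_{x||y}\colon b_{x|y}\Rightarrow b_{y|x}^{-1}$, natural in $y$, such that $v_{x||y\otimes z}$ corresponds, via $R(x|y,z)$ and the mate of $S(y,z|x)$, to the composite of $v_{x||y}$ and $v_{x||z}$. A 1-morphism $(x,v_{x||-})\to(x',v_{x'||-})$ is a 1-morphism $f\colon x\to x'$ of $\mathcal L$ such that for every $y$ the prism formed by $v_{x||y}$, $v_{x'||y}$ and the naturality 2-isomorphisms $b_{f|y}$,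 $b_{y|f}$ commutes. The 2-morphisms are those of $\mathcal L$. Let $(\mathbb 1,v)$ be any object of $\mathcal Z_{(2)}(\mathcal L)$ lying over the unit object $\mathbb 1$ of $\mathcal L$, for instance the unit object of $\mathcal Z_{(2)}(\mathcal L)$, for which $v$ is the trivial one. (a) (Bosonic case.) If $\mathcal L$ is strongly fusion, i.e. $\mathrm{End}_{\mathcal L}(\mathbb 1)\simeq \mathrm{Vec}$ as monoidal $\mathbb C$-linear categories (finite-dimensional vector spaces), then the forgetful functor $\mathrm{End}_{\mathcal Z_{(2)}(\mathcal L)}(\mathbb 1,v)\to \mathrm{End}_{\mathcal L}(\mathbb 1)$ is an equivalence and $\mathrm{End}_{\mathcal Z_{(2)}(\mathcal L)}(\mathbb 1,v)\simeq\mathrm{Vec}$ as monoidal $\mathbb C$-linear categories. (b) (Super case.) Suppose that $\mathcal L$ is moreover enriched over super vector spaces, presented by parity shifts: a strong transformation of the identity with components $\Pi_x\colon x\to x$, an invertible modification $\Pi^2\cong \mathrm{id}$, exchange isomorphism of $\Pi_x$ with itself equal to $-1$, and invertible modifications $\Pi_x\otimes y\cong \Pi_{x\otimes y}\cong x\otimes\Pi_y$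 compatible with $\Pi^2\cong\mathrm{id}$, the associator, the unitors and the braiding. If $\mathcal L$ is strongly super fusion, i.e. $\mathrm{End}_{\mathcal L}(\mathbb 1)\simeq\mathrm{SVec}$ as monoidal $\mathbb C$-linear categories with $\Pi_{\mathbb 1}$ corresponding to the odd line, then the forgetful functor $\mathrm{End}_{\mathcal Z_{(2)}(\mathcal L)}(\mathbb 1,v)\to\mathrm{End}_{\mathcal L}(\mathbb 1)$ is an equivalence, $\Pi_{\mathbb 1}$ is a 1-morphism of $\mathcal Z_{(2)}(\mathcal L)$, and $\mathrm{End}_{\mathcal Z_{(2)}(\mathcal L)}(\mathbb 1,v)\simeq\mathrm{SVec}$ as monoidal $\mathbb C$-linear categories, with $\Pi_{\mathbb 1}$ corresponding to the odd line. In either case $\mathcal Z_{(2)}(\mathcal L)$ contains no nontrivial line operators. -/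

import Mathlib

open CategoryTheory Category Bicategory
open scoped Pseudofunctor.StrongTrans

universe w w₁ w₂ w₃ v v₁ v₂ v₃ u u₁ u₂ u₃

namespace Tricat

section Generalities

variable {X : Type u₁} [Bicategory.{w₁, v₁} X] {B : Type u₂} [Bicategory.{w₂, v₂} B]
  {C : Type u₃} [Bicategory.{w₃, v₃} C]

/-- The constant pseudofunctor. -/
def const (X : Type u₁) [Bicategory.{w₁, v₁} X] (c : C) : X ⥤ᵖ C where
  obj _ := c
  map _ := 𝟙 c
  map₂ _ := 𝟙 _
  mapId _ := Iso.refl _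
  mapComp _ _ := (λ_ (𝟙 c)).symm
  map₂_whisker_left := by intros; simp
  map₂_whisker_right := by intros; simp
  map₂_associator := by intros; simp
  map₂_left_unitor := by intros; simp
  map₂_right_unitor := by intros; simp

/-- The pairing `x ↦ (F x, G x)` of two pseudofunctors. -/
def pair (F : X ⥤ᵖ B) (G : X ⥤ᵖ C) : X ⥤ᵖ B × C where
  obj x := (F.obj x, G.obj x)
  map f := (F.map f, G.map f)
  map₂ η := (F.map₂ η, G.map₂ η)
  map₂_id _ := Prod.ext (F.map₂_id _) (G.map₂_id _)
  map₂_comp _ _ := Prod.ext (F.map₂_comp _ _) (G.map₂_comp _ _)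
  mapId x := Iso.prod (F.mapId x) (G.mapId x)
  mapComp f g := Iso.prod (F.mapComp f g) (G.mapComp f g)
  map₂_whisker_left f _ _ η := Prod.ext (F.map₂_whisker_left f η) (G.map₂_whisker_left f η)
  map₂_whisker_right η h := Prod.ext (F.map₂_whisker_right η h) (G.map₂_whisker_right η h)
  map₂_associator f g h := Prod.ext (F.map₂_associator f g h) (G.map₂_associator f g h)
  map₂_left_unitor f := Prod.ext (F.map₂_left_unitor f) (G.map₂_left_unitor f)
  map₂_right_unitor f := Prod.ext (F.map₂_right_unitor f) (G.map₂_right_unitor f)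

/-- The pairing of two strong transformations. -/
def pairHom {F F' : X ⥤ᵖ B} {G G' : X ⥤ᵖ C} (η : F ⟶ F') (θ : G ⟶ G') :
    pair F G ⟶ pair F' G' where
  app x := (η.app x, θ.app x)
  naturality f := Iso.prod (η.naturality f) (θ.naturality f)
  naturality_naturality κ := Prod.ext (η.naturality_naturality κ) (θ.naturality_naturality κ)
  naturality_id x := Prod.ext (η.naturality_id x) (θ.naturality_id x)
  naturality_comp f g := Prod.ext (η.naturality_comp f g) (θ.naturality_comp f g)

/-- Postcomposition of a strong transformation with a pseudofunctor. -/
def postcomp {F F' : X ⥤ᵖ B} (η : F ⟶ F') (K : B ⥤ᵖ C) : F.comp K ⟶ F'.comp K where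
  app x := K.map (η.app x)
  naturality f := (K.mapComp (F.map f) (η.app _)).symm ≪≫ K.map₂Iso (η.naturality f) ≪≫
    K.mapComp (η.app _) (F'.map f)
  naturality_naturality {a b f g} κ := by
    have h := congrArg K.map₂ (η.naturality_naturality κ)
    simp only [K.map₂_comp, K.map₂_whisker_left, K.map₂_whisker_right, assoc] at h
    change K.map₂ (F.map₂ κ) ▷ K.map (η.app b) ≫ (K.mapComp (F.map g) (η.app _)).inv ≫
      K.map₂ (η.naturality g).hom ≫ (K.mapComp (η.app _) (F'.map g)).hom =
      ((K.mapComp (F.map f) (η.app _)).inv ≫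
      K.map₂ (η.naturality f).hom ≫ (K.mapComp (η.app _) (F'.map f)).hom) ≫
        K.map (η.app a) ◁ K.map₂ (F'.map₂ κ)
    rw [← cancel_epi (K.mapComp (F.map f) (η.app b)).hom,
      ← cancel_mono (K.mapComp (η.app a) (F'.map g)).inv]
    simpa using h
  naturality_id a := by
    have h := congrArg K.map₂ (η.naturality_id a)
    simp only [K.map₂_comp, K.map₂_whisker_left, K.map₂_whisker_right] at h
    change ((K.mapComp (F.map (𝟙 a)) (η.app _)).inv ≫ K.map₂ (η.naturality (𝟙 a)).hom ≫
      (K.mapComp (η.app _) (F'.map (𝟙 a))).hom) ≫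
        K.map (η.app a) ◁ (K.map₂ (F'.mapId a).hom ≫ (K.mapId _).hom) =
      (K.map₂ (F.mapId a).hom ≫ (K.mapId _).hom) ▷ K.map (η.app a) ≫
        (λ_ (K.map (η.app a))).hom ≫ (ρ_ (K.map (η.app a))).inv
    rw [← cancel_epi (K.mapComp (F.map (𝟙 a)) (η.app a)).hom]
    have e1 := K.map₂_whisker_left (η.app a) (F'.mapId a).hom
    have e2 := K.map₂_whisker_right (F.mapId a).hom (η.app a)
    have e3 : K.map₂ (ρ_ (η.app a)).inv ≫ (K.mapComp (η.app a) (𝟙 (F'.obj a))).hom ≫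
        K.map (η.app a) ◁ (K.mapId (F'.obj a)).hom ≫ (ρ_ (K.map (η.app a))).hom = 𝟙 _ := by
      rw [← K.map₂_right_unitor, ← K.map₂_comp, Iso.inv_hom_id, K.map₂_id]
    have h := congrArg K.map₂ (η.naturality_id a)
    simp only [K.map₂_comp] at h
    rw [e1, e2, Pseudofunctor.map₂_left_unitor] at h
    have h2 := h =≫ ((K.mapComp (η.app a) (𝟙 (F'.obj a))).hom ≫
        K.map (η.app a) ◁ (K.mapId (F'.obj a)).hom ≫ (ρ_ (K.map (η.app a))).hom)
    simp only [assoc, Iso.inv_hom_id_assoc, e3, comp_id] at h2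
    rw [← cancel_mono (ρ_ (K.map (η.app a))).hom]
    simpa using h2
  naturality_comp {a b c} f g := by
    have h := congrArg K.map₂ (η.naturality_comp f g)
    simp only [K.map₂_comp, K.map₂_whisker_left, K.map₂_whisker_right] at h
    change ((K.mapComp (F.map (f ≫ g)) (η.app _)).inv ≫ K.map₂ (η.naturality (f ≫ g)).hom ≫
      (K.mapComp (η.app _) (F'.map (f ≫ g))).hom) ≫
        K.map (η.app a) ◁ (K.map₂ (F'.mapComp f g).hom ≫ (K.mapComp _ _).hom) =
      (K.map₂ (F.mapComp f g).hom ≫ (K.mapComp _ _).hom) ▷ K.map (η.app c) ≫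
        (α_ (K.map (F.map f)) (K.map (F.map g)) (K.map (η.app c))).hom ≫
        K.map (F.map f) ◁ ((K.mapComp (F.map g) (η.app _)).inv ≫ K.map₂ (η.naturality g).hom ≫
          (K.mapComp (η.app _) (F'.map g)).hom) ≫
        (α_ (K.map (F.map f)) (K.map (η.app b)) (K.map (F'.map g))).inv ≫
        ((K.mapComp (F.map f) (η.app _)).inv ≫ K.map₂ (η.naturality f).hom ≫
          (K.mapComp (η.app _) (F'.map f)).hom) ▷ K.map (F'.map g) ≫
        (α_ (K.map (η.app a)) (K.map (F'.map f)) (K.map (F'.map g))).hom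
    rw [← cancel_epi (K.mapComp (F.map (f ≫ g)) (η.app c)).hom,
      ← cancel_mono (K.map (η.app a) ◁ (K.mapComp (F'.map f) (F'.map g)).inv),
      ← cancel_mono (K.mapComp (η.app a) (F'.map f ≫ F'.map g)).inv]
    have e : (K.mapComp (F.map f) (η.app b ≫ F'.map g)).inv ≫
        K.map₂ (α_ (F.map f) (η.app b) (F'.map g)).inv ≫
        (K.mapComp (F.map f ≫ η.app b) (F'.map g)).hom =
        K.map (F.map f) ◁ (K.mapComp (η.app b) (F'.map g)).hom ≫
          (α_ (K.map (F.map f)) (K.map (η.app b)) (K.map (F'.map g))).inv ≫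
          (K.mapComp (F.map f) (η.app b)).inv ▷ K.map (F'.map g) := by
      rw [← cancel_mono ((K.mapComp (F.map f) (η.app b)).hom ▷ K.map (F'.map g))]
      simp only [assoc, inv_hom_whiskerRight, comp_id]
      have := K.mapComp_assoc_right_hom (F.map f) (η.app b) (F'.map g)
      rw [← cancel_epi (K.mapComp (F.map f) (η.app b ≫ F'.map g)).hom, reassoc_of% this]
      simp
    simp at h ⊢
    rw [h]
    simp [reassoc_of% e]

/-- Precomposition of a strong transformation with a pseudofunctor. -/
def precomp (H : X ⥤ᵖ B) {F F' : B ⥤ᵖ C} (η : F ⟶ F') : H.comp F ⟶ H.comp F' where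
  app x := η.app (H.obj x)
  naturality f := η.naturality (H.map f)
  naturality_naturality κ := η.naturality_naturality (H.map₂ κ)
  naturality_id a := by
    have h := η.naturality_naturality (H.mapId a).hom
    have h' := η.naturality_id (H.obj a)
    change (η.naturality (H.map (𝟙 a))).hom ≫ η.app (H.obj a) ◁
      (F'.map₂ (H.mapId a).hom ≫ (F'.mapId (H.obj a)).hom) =
    (F.map₂ (H.mapId a).hom ≫ (F.mapId (H.obj a)).hom) ▷ η.app (H.obj a) ≫
      (λ_ (η.app (H.obj a))).hom ≫ (ρ_ (η.app (H.obj a))).inv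
    rw [Bicategory.whiskerLeft_comp, comp_whiskerRight, assoc, ← h', ← reassoc_of% h]
  naturality_comp {a b c} f g := by
    have h := η.naturality_naturality (H.mapComp f g).hom
    have h' := η.naturality_comp (H.map f) (H.map g)
    change (η.naturality (H.map (f ≫ g))).hom ≫ η.app (H.obj a) ◁
      (F'.map₂ (H.mapComp f g).hom ≫ (F'.mapComp (H.map f) (H.map g)).hom) =
    (F.map₂ (H.mapComp f g).hom ≫ (F.mapComp (H.map f) (H.map g)).hom) ▷ η.app (H.obj c) ≫
      (α_ (F.map (H.map f)) (F.map (H.map g)) (η.app (H.obj c))).hom ≫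
        F.map (H.map f) ◁ (η.naturality (H.map g)).hom ≫
          (α_ (F.map (H.map f)) (η.app (H.obj b)) (F'.map (H.map g))).inv ≫
            (η.naturality (H.map f)).hom ▷ F'.map (H.map g) ≫
              (α_ (η.app (H.obj a)) (F'.map (H.map f)) (F'.map (H.map g))).hom
    rw [Bicategory.whiskerLeft_comp, comp_whiskerRight, assoc, ← h', ← reassoc_of% h]

/-- The first projection. -/
def proj₁ (B : Type u₂) [Bicategory.{w₂, v₂} B] (C : Type u₃) [Bicategory.{w₃, v₃} C] :
    B × C ⥤ᵖ B where
  obj x := x.1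
  map f := f.1
  map₂ η := η.1
  mapId _ := Iso.refl _
  mapComp _ _ := Iso.refl _
  map₂_whisker_left _ _ _ _ := by simp
  map₂_whisker_right _ _ := by simp
  map₂_associator _ _ _ := by simp
  map₂_left_unitor _ := by simp
  map₂_right_unitor _ := by simp

/-- The second projection. -/
def proj₂ (B : Type u₂) [Bicategory.{w₂, v₂} B] (C : Type u₃) [Bicategory.{w₃, v₃} C] :
    B × C ⥤ᵖ C where
  obj x := x.2
  map f := f.2
  map₂ η := η.2
  mapId _ := Iso.refl _
  mapComp _ _ := Iso.refl _
  map₂_whisker_left _ _ _ _ := by simp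
  map₂_whisker_right _ _ := by simp
  map₂_associator _ _ _ := by simp
  map₂_left_unitor _ := by simp
  map₂_right_unitor _ := by simp

end Generalities

variable {L : Type u} [Bicategory.{w, v} L]
  {X : Type u₁} [Bicategory.{w₁, v₁} X] (T : L × L ⥤ᵖ L)

/-- The action of a tensor pseudofunctor on a pair of 2-morphisms. -/
def tm₂ {x x' y y' : L} {f f' : x ⟶ x'} {g g' : y ⟶ y'} (α : f ⟶ f') (β : g ⟶ g') :
    T.map ((f, g) : (x, y) ⟶ (x', y')) ⟶ T.map ((f', g') : (x, y) ⟶ (x', y')) :=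
  T.map₂ ((α, β) : ((f, g) : (x, y) ⟶ (x', y')) ⟶ (f', g'))

theorem tm₂_id {x x' y y' : L} (f : x ⟶ x') (g : y ⟶ y') :
    tm₂ T (𝟙 f) (𝟙 g) = 𝟙 _ := T.map₂_id _

theorem tm₂_comp {x x' y y' : L} {f f' f'' : x ⟶ x'} {g g' g'' : y ⟶ y'} (α : f ⟶ f')
    (β : g ⟶ g') (α' : f' ⟶ f'') (β' : g' ⟶ g'') :
    tm₂ T α β ≫ tm₂ T α' β' = tm₂ T (α ≫ α') (β ≫ β') := (T.map₂_comp _ _).symm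

theorem tm₂_comp_assoc {x x' y y' : L} {f f' f'' : x ⟶ x'} {g g' g'' : y ⟶ y'} (α : f ⟶ f')
    (β : g ⟶ g') (α' : f' ⟶ f'') (β' : g' ⟶ g'') {h} (k : _ ⟶ h) :
    tm₂ T α β ≫ tm₂ T α' β' ≫ k = tm₂ T (α ≫ α') (β ≫ β') ≫ k := by
  rw [← assoc, tm₂_comp]

/-- The pointwise product `x ↦ F x ⊗ G x`. -/
def tens (F G : X ⥤ᵖ L) : X ⥤ᵖ L := (pair F G).comp T

def tensHom {F F' G G' : X ⥤ᵖ L} (η : F ⟶ F') (θ : G ⟶ G') : tens T F G ⟶ tens T F' G' :=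
  postcomp (pairHom η θ) T

abbrev q₁ (L : Type u) [Bicategory.{w, v} L] : L × L × L ⥤ᵖ L := proj₁ L (L × L)
abbrev q₂ (L : Type u) [Bicategory.{w, v} L] : L × L × L ⥤ᵖ L :=
  (proj₂ L (L × L)).comp (proj₁ L L)
abbrev q₃ (L : Type u) [Bicategory.{w, v} L] : L × L × L ⥤ᵖ L :=
  (proj₂ L (L × L)).comp (proj₂ L L)

theorem tensl_mapId (F G K : X ⥤ᵖ L) (x : X) :
    ((tens T (tens T F G) K).mapId x).hom =
      (((pair F (pair G K)).comp (tens T (tens T (q₁ L) (q₂ L)) (q₃ L))).mapId x).hom := by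
  change tm₂ T (tm₂ T (F.mapId x).hom (G.mapId x).hom ≫ (T.mapId (F.obj x, G.obj x)).hom)
      (K.mapId x).hom ≫ (T.mapId (T.obj (F.obj x, G.obj x), K.obj x)).hom =
    tm₂ T (tm₂ T (F.mapId x).hom (G.mapId x).hom) (K.mapId x).hom ≫
      tm₂ T (tm₂ T (𝟙 (𝟙 (F.obj x))) (𝟙 (𝟙 (G.obj x)) ≫ 𝟙 (𝟙 (G.obj x))) ≫
        (T.mapId (F.obj x, G.obj x)).hom) (𝟙 (𝟙 (K.obj x)) ≫ 𝟙 (𝟙 (K.obj x))) ≫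
        (T.mapId (T.obj (F.obj x, G.obj x), K.obj x)).hom
  simp only [tm₂_comp_assoc, comp_id]

theorem tensl_mapComp (F G K : X ⥤ᵖ L) {x y z : X} (f : x ⟶ y) (g : y ⟶ z) :
    ((tens T (tens T F G) K).mapComp f g).hom =
      (((pair F (pair G K)).comp (tens T (tens T (q₁ L) (q₂ L)) (q₃ L))).mapComp f g).hom := by
  change tm₂ T (tm₂ T (F.mapComp f g).hom (G.mapComp f g).hom ≫
      (T.mapComp (a := (F.obj x, G.obj x)) (b := (F.obj y, G.obj y)) (c := (F.obj z, G.obj z))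
        (F.map f, G.map f) (F.map g, G.map g)).hom)
      (K.mapComp f g).hom ≫ (T.mapComp (a := (T.obj (F.obj x, G.obj x), K.obj x))
        (b := (T.obj (F.obj y, G.obj y), K.obj y)) (c := (T.obj (F.obj z, G.obj z), K.obj z))
        (T.map (F.map f, G.map f), K.map f) (T.map (F.map g, G.map g), K.map g)).hom =
    tm₂ T (tm₂ T (F.mapComp f g).hom (G.mapComp f g).hom) (K.mapComp f g).hom ≫
      tm₂ T (tm₂ T (𝟙 (F.map f ≫ F.map g)) (𝟙 (G.map f ≫ G.map g) ≫ 𝟙 (G.map f ≫ G.map g)) ≫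
        (T.mapComp (a := (F.obj x, G.obj x)) (b := (F.obj y, G.obj y)) (c := (F.obj z, G.obj z))
        (F.map f, G.map f) (F.map g, G.map g)).hom) (𝟙 (K.map f ≫ K.map g) ≫ 𝟙 (K.map f ≫ K.map g)) ≫
        (T.mapComp (a := (T.obj (F.obj x, G.obj x), K.obj x))
        (b := (T.obj (F.obj y, G.obj y), K.obj y)) (c := (T.obj (F.obj z, G.obj z), K.obj z))
        (T.map (F.map f, G.map f), K.map f) (T.map (F.map g, G.map g), K.map g)).hom
  simp only [tm₂_comp_assoc, comp_id]

theorem tensr_mapId (F G K : X ⥤ᵖ L) (x : X) :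
    ((tens T F (tens T G K)).mapId x).hom =
      (((pair F (pair G K)).comp (tens T (q₁ L) (tens T (q₂ L) (q₃ L)))).mapId x).hom := by
  change tm₂ T (F.mapId x).hom
      (tm₂ T (G.mapId x).hom (K.mapId x).hom ≫ (T.mapId (G.obj x, K.obj x)).hom) ≫
      (T.mapId (F.obj x, T.obj (G.obj x, K.obj x))).hom =
    tm₂ T (F.mapId x).hom (tm₂ T (G.mapId x).hom (K.mapId x).hom) ≫
      tm₂ T (𝟙 (𝟙 (F.obj x))) (tm₂ T (𝟙 (𝟙 (G.obj x)) ≫ 𝟙 (𝟙 (G.obj x)))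
        (𝟙 (𝟙 (K.obj x)) ≫ 𝟙 (𝟙 (K.obj x))) ≫ (T.mapId (G.obj x, K.obj x)).hom) ≫
      (T.mapId (F.obj x, T.obj (G.obj x, K.obj x))).hom
  simp only [tm₂_comp_assoc, comp_id]

theorem tensr_mapComp (F G K : X ⥤ᵖ L) {x y z : X} (f : x ⟶ y) (g : y ⟶ z) :
    ((tens T F (tens T G K)).mapComp f g).hom =
      (((pair F (pair G K)).comp (tens T (q₁ L) (tens T (q₂ L) (q₃ L)))).mapComp f g).hom := by
  change tm₂ T (F.mapComp f g).hom (tm₂ T (G.mapComp f g).hom (K.mapComp f g).hom ≫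
      (T.mapComp (a := (G.obj x, K.obj x)) (b := (G.obj y, K.obj y)) (c := (G.obj z, K.obj z))
        (G.map f, K.map f) (G.map g, K.map g)).hom) ≫
      (T.mapComp (a := (F.obj x, T.obj (G.obj x, K.obj x)))
        (b := (F.obj y, T.obj (G.obj y, K.obj y))) (c := (F.obj z, T.obj (G.obj z, K.obj z)))
        (F.map f, T.map (G.map f, K.map f)) (F.map g, T.map (G.map g, K.map g))).hom =
    tm₂ T (F.mapComp f g).hom (tm₂ T (G.mapComp f g).hom (K.mapComp f g).hom) ≫
      tm₂ T (𝟙 (F.map f ≫ F.map g)) (tm₂ T (𝟙 (G.map f ≫ G.map g) ≫ 𝟙 (G.map f ≫ G.map g))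
        (𝟙 (K.map f ≫ K.map g) ≫ 𝟙 (K.map f ≫ K.map g)) ≫
      (T.mapComp (a := (G.obj x, K.obj x)) (b := (G.obj y, K.obj y)) (c := (G.obj z, K.obj z))
        (G.map f, K.map f) (G.map g, K.map g)).hom) ≫
      (T.mapComp (a := (F.obj x, T.obj (G.obj x, K.obj x)))
        (b := (F.obj y, T.obj (G.obj y, K.obj y))) (c := (F.obj z, T.obj (G.obj z, K.obj z)))
        (F.map f, T.map (G.map f, K.map f)) (F.map g, T.map (G.map g, K.map g))).hom
  simp only [tm₂_comp_assoc, comp_id]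

theorem tens_mapId (F G : X ⥤ᵖ L) (x : X) :
    ((tens T F G).mapId x).hom =
      (((pair F G).comp (tens T (proj₁ L L) (proj₂ L L))).mapId x).hom := by
  change tm₂ T (F.mapId x).hom (G.mapId x).hom ≫ (T.mapId (F.obj x, G.obj x)).hom =
    tm₂ T (F.mapId x).hom (G.mapId x).hom ≫ tm₂ T (𝟙 (𝟙 (F.obj x))) (𝟙 (𝟙 (G.obj x))) ≫
      (T.mapId (F.obj x, G.obj x)).hom
  simp only [tm₂_comp_assoc, comp_id]

theorem tens_mapComp (F G : X ⥤ᵖ L) {x y z : X} (f : x ⟶ y) (g : y ⟶ z) :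
    ((tens T F G).mapComp f g).hom =
      (((pair F G).comp (tens T (proj₁ L L) (proj₂ L L))).mapComp f g).hom := by
  change tm₂ T (F.mapComp f g).hom (G.mapComp f g).hom ≫
      (T.mapComp (a := (F.obj x, G.obj x)) (b := (F.obj y, G.obj y)) (c := (F.obj z, G.obj z))
        (F.map f, G.map f) (F.map g, G.map g)).hom =
    tm₂ T (F.mapComp f g).hom (G.mapComp f g).hom ≫
      tm₂ T (𝟙 (F.map f ≫ F.map g)) (𝟙 (G.map f ≫ G.map g)) ≫
      (T.mapComp (a := (F.obj x, G.obj x)) (b := (F.obj y, G.obj y)) (c := (F.obj z, G.obj z))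
        (F.map f, G.map f) (F.map g, G.map g)).hom
  simp only [tm₂_comp_assoc, comp_id]

theorem tenss_mapId (F G : X ⥤ᵖ L) (x : X) :
    ((tens T G F).mapId x).hom =
      (((pair F G).comp (tens T (proj₂ L L) (proj₁ L L))).mapId x).hom := by
  change tm₂ T (G.mapId x).hom (F.mapId x).hom ≫ (T.mapId (G.obj x, F.obj x)).hom =
    tm₂ T (G.mapId x).hom (F.mapId x).hom ≫ tm₂ T (𝟙 (𝟙 (G.obj x))) (𝟙 (𝟙 (F.obj x))) ≫
      (T.mapId (G.obj x, F.obj x)).hom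
  simp only [tm₂_comp_assoc, comp_id]

theorem tenss_mapComp (F G : X ⥤ᵖ L) {x y z : X} (f : x ⟶ y) (g : y ⟶ z) :
    ((tens T G F).mapComp f g).hom =
      (((pair F G).comp (tens T (proj₂ L L) (proj₁ L L))).mapComp f g).hom := by
  change tm₂ T (G.mapComp f g).hom (F.mapComp f g).hom ≫
      (T.mapComp (a := (G.obj x, F.obj x)) (b := (G.obj y, F.obj y)) (c := (G.obj z, F.obj z))
        (G.map f, F.map f) (G.map g, F.map g)).hom =
    tm₂ T (G.mapComp f g).hom (F.mapComp f g).hom ≫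
      tm₂ T (𝟙 (G.map f ≫ G.map g)) (𝟙 (F.map f ≫ F.map g)) ≫
      (T.mapComp (a := (G.obj x, F.obj x)) (b := (G.obj y, F.obj y)) (c := (G.obj z, F.obj z))
        (G.map f, F.map f) (G.map g, F.map g)).hom
  simp only [tm₂_comp_assoc, comp_id]

theorem unitl_mapId (I : L) (F : X ⥤ᵖ L) (x : X) :
    ((tens T (const X I) F).mapId x).hom =
      ((F.comp (tens T (const L I) (Pseudofunctor.id L))).mapId x).hom := by
  change tm₂ T (𝟙 (𝟙 I)) (F.mapId x).hom ≫ (T.mapId (I, F.obj x)).hom =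
    tm₂ T (𝟙 (𝟙 I)) (F.mapId x).hom ≫ tm₂ T (𝟙 (𝟙 I)) (𝟙 (𝟙 (F.obj x))) ≫
      (T.mapId (I, F.obj x)).hom
  simp only [tm₂_comp_assoc, comp_id]

theorem unitl_mapComp (I : L) (F : X ⥤ᵖ L) {x y z : X} (f : x ⟶ y) (g : y ⟶ z) :
    ((tens T (const X I) F).mapComp f g).hom =
      ((F.comp (tens T (const L I) (Pseudofunctor.id L))).mapComp f g).hom := by
  change tm₂ T (λ_ (𝟙 I)).inv (F.mapComp f g).hom ≫
      (T.mapComp (a := (I, F.obj x)) (b := (I, F.obj y)) (c := (I, F.obj z))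
        (𝟙 I, F.map f) (𝟙 I, F.map g)).hom =
    tm₂ T (𝟙 (𝟙 I)) (F.mapComp f g).hom ≫ tm₂ T (λ_ (𝟙 I)).inv (𝟙 (F.map f ≫ F.map g)) ≫
      (T.mapComp (a := (I, F.obj x)) (b := (I, F.obj y)) (c := (I, F.obj z))
        (𝟙 I, F.map f) (𝟙 I, F.map g)).hom
  simp only [tm₂_comp_assoc, comp_id, id_comp]

theorem unitr_mapId (I : L) (F : X ⥤ᵖ L) (x : X) :
    ((tens T F (const X I)).mapId x).hom =
      ((F.comp (tens T (Pseudofunctor.id L) (const L I))).mapId x).hom := by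
  change tm₂ T (F.mapId x).hom (𝟙 (𝟙 I)) ≫ (T.mapId (F.obj x, I)).hom =
    tm₂ T (F.mapId x).hom (𝟙 (𝟙 I)) ≫ tm₂ T (𝟙 (𝟙 (F.obj x))) (𝟙 (𝟙 I)) ≫
      (T.mapId (F.obj x, I)).hom
  simp only [tm₂_comp_assoc, comp_id]

theorem unitr_mapComp (I : L) (F : X ⥤ᵖ L) {x y z : X} (f : x ⟶ y) (g : y ⟶ z) :
    ((tens T F (const X I)).mapComp f g).hom =
      ((F.comp (tens T (Pseudofunctor.id L) (const L I))).mapComp f g).hom := by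
  change tm₂ T (F.mapComp f g).hom (λ_ (𝟙 I)).inv ≫
      (T.mapComp (a := (F.obj x, I)) (b := (F.obj y, I)) (c := (F.obj z, I))
        (F.map f, 𝟙 I) (F.map g, 𝟙 I)).hom =
    tm₂ T (F.mapComp f g).hom (𝟙 (𝟙 I)) ≫ tm₂ T (𝟙 (F.map f ≫ F.map g)) (λ_ (𝟙 I)).inv ≫
      (T.mapComp (a := (F.obj x, I)) (b := (F.obj y, I)) (c := (F.obj z, I))
        (F.map f, 𝟙 I) (F.map g, 𝟙 I)).hom
  simp only [tm₂_comp_assoc, comp_id, id_comp]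

theorem id_mapId (F : X ⥤ᵖ L) (x : X) :
    (F.mapId x).hom = ((F.comp (Pseudofunctor.id L)).mapId x).hom := by
  change _ = (F.mapId x).hom ≫ 𝟙 _
  rw [comp_id]

theorem id_mapComp (F : X ⥤ᵖ L) {x y z : X} (f : x ⟶ y) (g : y ⟶ z) :
    (F.mapComp f g).hom = ((F.comp (Pseudofunctor.id L)).mapComp f g).hom := by
  change _ = (F.mapComp f g).hom ≫ 𝟙 _
  rw [comp_id]

variable {T}

/-- The associator `(F x ⊗ G x) ⊗ K x ⟶ F x ⊗ (G x ⊗ K x)`. -/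
def assocAt (a : tens T (tens T (q₁ L) (q₂ L)) (q₃ L) ⟶ tens T (q₁ L) (tens T (q₂ L) (q₃ L)))
    (F G K : X ⥤ᵖ L) : tens T (tens T F G) K ⟶ tens T F (tens T G K) where
  app x := a.app (F.obj x, G.obj x, K.obj x)
  naturality f := (precomp (pair F (pair G K)) a).naturality f
  naturality_naturality κ := (precomp (pair F (pair G K)) a).naturality_naturality κ
  naturality_id x := by
    rw [tensl_mapId, tensr_mapId]
    exact (precomp (pair F (pair G K)) a).naturality_id x
  naturality_comp f g := by
    rw [tensl_mapComp, tensr_mapComp]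
    exact (precomp (pair F (pair G K)) a).naturality_comp f g

/-- The inverse associator `F x ⊗ (G x ⊗ K x) ⟶ (F x ⊗ G x) ⊗ K x`. -/
def assocInvAt
    (a' : tens T (q₁ L) (tens T (q₂ L) (q₃ L)) ⟶ tens T (tens T (q₁ L) (q₂ L)) (q₃ L))
    (F G K : X ⥤ᵖ L) : tens T F (tens T G K) ⟶ tens T (tens T F G) K where
  app x := a'.app (F.obj x, G.obj x, K.obj x)
  naturality f := (precomp (pair F (pair G K)) a').naturality f
  naturality_naturality κ := (precomp (pair F (pair G K)) a').naturality_naturality κ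
  naturality_id x := by
    rw [tensl_mapId, tensr_mapId]
    exact (precomp (pair F (pair G K)) a').naturality_id x
  naturality_comp f g := by
    rw [tensl_mapComp, tensr_mapComp]
    exact (precomp (pair F (pair G K)) a').naturality_comp f g

/-- The braiding `F x ⊗ G x ⟶ G x ⊗ F x`. -/
def braidAt (b : tens T (proj₁ L L) (proj₂ L L) ⟶ tens T (proj₂ L L) (proj₁ L L))
    (F G : X ⥤ᵖ L) : tens T F G ⟶ tens T G F where
  app x := b.app (F.obj x, G.obj x)
  naturality f := (precomp (pair F G) b).naturality f
  naturality_naturality κ := (precomp (pair F G) b).naturality_naturality κ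
  naturality_id x := by
    rw [tens_mapId, tenss_mapId]
    exact (precomp (pair F G) b).naturality_id x
  naturality_comp f g := by
    rw [tens_mapComp, tenss_mapComp]
    exact (precomp (pair F G) b).naturality_comp f g

/-- The left unitor `I ⊗ F x ⟶ F x`. -/
def leftUnitAt {I : L} (l : tens T (const L I) (Pseudofunctor.id L) ⟶ Pseudofunctor.id L)
    (F : X ⥤ᵖ L) : tens T (const X I) F ⟶ F where
  app x := l.app (F.obj x)
  naturality f := (precomp F l).naturality f
  naturality_naturality κ := (precomp F l).naturality_naturality κ
  naturality_id x := by
    rw [unitl_mapId, id_mapId]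
    exact (precomp F l).naturality_id x
  naturality_comp f g := by
    rw [unitl_mapComp, id_mapComp]
    exact (precomp F l).naturality_comp f g

/-- The right unitor `F x ⊗ I ⟶ F x`. -/
def rightUnitAt {I : L} (r : tens T (Pseudofunctor.id L) (const L I) ⟶ Pseudofunctor.id L)
    (F : X ⥤ᵖ L) : tens T F (const X I) ⟶ F where
  app x := r.app (F.obj x)
  naturality f := (precomp F r).naturality f
  naturality_naturality κ := (precomp F r).naturality_naturality κ
  naturality_id x := by
    rw [unitr_mapId, id_mapId]
    exact (precomp F r).naturality_id x
  naturality_comp f g := by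
    rw [unitr_mapComp, id_mapComp]
    exact (precomp F r).naturality_comp f g

/-- The reverse braiding `F x ⊗ G x ⟶ G x ⊗ F x`, given by the inverse of the braiding
`G x ⊗ F x ⟶ F x ⊗ G x`. -/
def braidRevAt (b' : tens T (proj₂ L L) (proj₁ L L) ⟶ tens T (proj₁ L L) (proj₂ L L))
    (F G : X ⥤ᵖ L) : tens T F G ⟶ tens T G F where
  app x := b'.app (G.obj x, F.obj x)
  naturality f := (precomp (pair G F) b').naturality f
  naturality_naturality κ := (precomp (pair G F) b').naturality_naturality κ
  naturality_id x := by
    rw [tens_mapId, tenss_mapId]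
    exact (precomp (pair G F) b').naturality_id x
  naturality_comp f g := by
    rw [tens_mapComp, tenss_mapComp]
    exact (precomp (pair G F) b').naturality_comp f g

/-! ### Monoidal bicategories -/

/-- The tensor product, the unit, the associator and the unitors of a monoidal bicategory. The
associator and the unitors are adjoint equivalences of pseudofunctors. -/
class TensorData (L : Type u) [Bicategory.{w, v} L] where
  T : L × L ⥤ᵖ L
  I : L
  assoc : tens T (tens T (q₁ L) (q₂ L)) (q₃ L) ≌ tens T (q₁ L) (tens T (q₂ L) (q₃ L))
  leftUnit : tens T (const L I) (Pseudofunctor.id L) ≌ Pseudofunctor.id L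
  rightUnit : tens T (Pseudofunctor.id L) (const L I) ≌ Pseudofunctor.id L

section Tensor

variable [TensorData L]

/-- The unit object. -/
abbrev unit (L : Type u) [Bicategory.{w, v} L] [TensorData L] : L := TensorData.I

abbrev tn (F G : X ⥤ᵖ L) : X ⥤ᵖ L := tens TensorData.T F G

/-- The constant pseudofunctor at the unit object. -/
abbrev one (X : Type u₁) [Bicategory.{w₁, v₁} X] (L : Type u) [Bicategory.{w, v} L]
    [TensorData L] : X ⥤ᵖ L := const X (unit L)

abbrev tnL (F : X ⥤ᵖ L) {G G' : X ⥤ᵖ L} (θ : G ⟶ G') : tn F G ⟶ tn F G' :=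
  tensHom TensorData.T (𝟙 F) θ

abbrev tnR {F F' : X ⥤ᵖ L} (θ : F ⟶ F') (G : X ⥤ᵖ L) : tn F G ⟶ tn F' G :=
  tensHom TensorData.T θ (𝟙 G)

abbrev aT (F G K : X ⥤ᵖ L) : tn (tn F G) K ⟶ tn F (tn G K) :=
  assocAt TensorData.assoc.hom F G K

abbrev aT' (F G K : X ⥤ᵖ L) : tn F (tn G K) ⟶ tn (tn F G) K :=
  assocInvAt TensorData.assoc.inv F G K

abbrev lT (F : X ⥤ᵖ L) : tn (one X L) F ⟶ F := leftUnitAt TensorData.leftUnit.hom F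

abbrev rT (F : X ⥤ᵖ L) : tn F (one X L) ⟶ F := rightUnitAt TensorData.rightUnit.hom F

/-- The tensor product of objects. -/
abbrev tobj (x y : L) : L := TensorData.T.obj (x, y)

local infixr:70 " ⊠ " => tobj

/-- `f ⊗ y` for a 1-morphism `f`. -/
abbrev wr {x x' : L} (f : x ⟶ x') (y : L) : x ⊠ y ⟶ x' ⊠ y :=
  TensorData.T.map (X := (x, y)) (Y := (x', y)) (f, 𝟙 y)

/-- `x ⊗ g` for a 1-morphism `g`. -/
abbrev wl (x : L) {y y' : L} (g : y ⟶ y') : x ⊠ y ⟶ x ⊠ y' :=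
  TensorData.T.map (X := (x, y)) (Y := (x, y')) (𝟙 x, g)

local infixl:81 " ▹ " => wr
local infixr:81 " ◃ " => wl

/-- `α ⊗ y` for a 2-morphism `α`. -/
abbrev wr₂ {x x' : L} {f g : x ⟶ x'} (α : f ⟶ g) (y : L) : f ▹ y ⟶ g ▹ y :=
  tm₂ TensorData.T α (𝟙 (𝟙 y))

/-- `x ⊗ α` for a 2-morphism `α`. -/
abbrev wl₂ (x : L) {y y' : L} {f g : y ⟶ y'} (α : f ⟶ g) : x ◃ f ⟶ x ◃ g :=
  tm₂ TensorData.T (𝟙 (𝟙 x)) α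

/-- The action of the tensor product on a pair of invertible 2-morphisms. -/
abbrev tIso {x x' y y' : L} {f f' : x ⟶ x'} {g g' : y ⟶ y'} (α : f ≅ f') (β : g ≅ g') :
    TensorData.T.map ((f, g) : (x, y) ⟶ (x', y')) ≅
      TensorData.T.map ((f', g') : (x, y) ⟶ (x', y')) :=
  TensorData.T.map₂Iso (Iso.prod α β)

abbrev wrIso {x x' : L} {f g : x ⟶ x'} (α : f ≅ g) (y : L) : f ▹ y ≅ g ▹ y :=
  tIso α (Iso.refl (𝟙 y))

abbrev wlIso (x : L) {y y' : L} {f g : y ⟶ y'} (α : f ≅ g) : x ◃ f ≅ x ◃ g :=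
  tIso (Iso.refl (𝟙 x)) α

/-- The tensor product preserves identity 1-morphisms. -/
def tId (x y : L) : TensorData.T.map ((𝟙 x, 𝟙 y) : (x, y) ⟶ (x, y)) ≅ 𝟙 (x ⊠ y) :=
  TensorData.T.mapId (x, y)

/-- The tensor product preserves composition in the first variable. -/
def wrComp {x x' x'' : L} (f : x ⟶ x') (g : x' ⟶ x'') (y : L) :
    (f ≫ g) ▹ y ≅ f ▹ y ≫ g ▹ y :=
  tIso (Iso.refl (f ≫ g)) (λ_ (𝟙 y)).symm ≪≫
    TensorData.T.mapComp (a := (x, y)) (b := (x', y)) (c := (x'', y)) (f, 𝟙 y) (g, 𝟙 y)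

/-- The tensor product preserves composition in the second variable. -/
def wlComp (x : L) {y y' y'' : L} (f : y ⟶ y') (g : y' ⟶ y'') :
    x ◃ (f ≫ g) ≅ x ◃ f ≫ x ◃ g :=
  tIso (λ_ (𝟙 x)).symm (Iso.refl (f ≫ g)) ≪≫
    TensorData.T.mapComp (a := (x, y)) (b := (x, y')) (c := (x, y'')) (𝟙 x, f) (𝟙 x, g)

def wrComp₃ {x₀ x₁ x₂ x₃ : L} (f : x₀ ⟶ x₁) (g : x₁ ⟶ x₂) (h : x₂ ⟶ x₃) (y : L) :
    (f ≫ g ≫ h) ▹ y ≅ f ▹ y ≫ g ▹ y ≫ h ▹ y :=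
  wrComp f (g ≫ h) y ≪≫ whiskerLeftIso _ (wrComp g h y)

def wlComp₃ (x : L) {y₀ y₁ y₂ y₃ : L} (f : y₀ ⟶ y₁) (g : y₁ ⟶ y₂) (h : y₂ ⟶ y₃) :
    x ◃ (f ≫ g ≫ h) ≅ x ◃ f ≫ x ◃ g ≫ x ◃ h :=
  wlComp x f (g ≫ h) ≪≫ whiskerLeftIso _ (wlComp x g h)

def wrComp₅ {x₀ x₁ x₂ x₃ x₄ x₅ : L} (f : x₀ ⟶ x₁) (g : x₁ ⟶ x₂) (h : x₂ ⟶ x₃) (i : x₃ ⟶ x₄)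
    (j : x₄ ⟶ x₅) (y : L) :
    (f ≫ g ≫ h ≫ i ≫ j) ▹ y ≅ f ▹ y ≫ g ▹ y ≫ h ▹ y ≫ i ▹ y ≫ j ▹ y :=
  wrComp f (g ≫ h ≫ i ≫ j) y ≪≫ whiskerLeftIso _ (wrComp g (h ≫ i ≫ j) y ≪≫
    whiskerLeftIso _ (wrComp₃ h i j y))

def wlComp₅ (x : L) {y₀ y₁ y₂ y₃ y₄ y₅ : L} (f : y₀ ⟶ y₁) (g : y₁ ⟶ y₂) (h : y₂ ⟶ y₃)
    (i : y₃ ⟶ y₄) (j : y₄ ⟶ y₅) :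
    x ◃ (f ≫ g ≫ h ≫ i ≫ j) ≅ x ◃ f ≫ x ◃ g ≫ x ◃ h ≫ x ◃ i ≫ x ◃ j :=
  wlComp x f (g ≫ h ≫ i ≫ j) ≪≫ whiskerLeftIso _ (wlComp x g (h ≫ i ≫ j) ≪≫
    whiskerLeftIso _ (wlComp₃ x h i j))

/-- The interchange of `f ⊗ y` and `x ⊗ g`. -/
def inter {x x' y y' : L} (f : x ⟶ x') (g : y ⟶ y') :
    f ▹ y ≫ x' ◃ g ≅ x ◃ g ≫ f ▹ y' :=
  (TensorData.T.mapComp (a := (x, y)) (b := (x', y)) (c := (x', y')) (f, 𝟙 y) (𝟙 x', g)).symm ≪≫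
    tIso (ρ_ f ≪≫ (λ_ f).symm) (λ_ g ≪≫ (ρ_ g).symm) ≪≫
    TensorData.T.mapComp (a := (x, y)) (b := (x, y')) (c := (x', y')) (𝟙 x, g) (f, 𝟙 y')

/-- The components of an invertible modification. -/
def isoApp {B : Type u₂} [Bicategory.{w₂, v₂} B] {F G : X ⥤ᵖ B} {η θ : F ⟶ G} (m : η ≅ θ)
    (x : X) : η.app x ≅ θ.app x where
  hom := m.hom.as.app x
  inv := m.inv.as.app x
  hom_inv_id := congrArg (fun k : η ⟶ η => k.as.app x) m.hom_inv_id
  inv_hom_id := congrArg (fun k : θ ⟶ θ => k.as.app x) m.inv_hom_id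

/-- The components of the associator and of its inverse. -/
abbrev as (x y z : L) : (x ⊠ y) ⊠ z ⟶ x ⊠ y ⊠ z :=
  (TensorData.assoc (L := L)).hom.app (x, y, z)

abbrev as' (x y z : L) : x ⊠ y ⊠ z ⟶ (x ⊠ y) ⊠ z :=
  (TensorData.assoc (L := L)).inv.app (x, y, z)

abbrev lu (x : L) : unit L ⊠ x ⟶ x := (TensorData.leftUnit (L := L)).hom.app x

abbrev ru (x : L) : x ⊠ unit L ⟶ x := (TensorData.rightUnit (L := L)).hom.app x

def asUnit (x y z : L) : 𝟙 ((x ⊠ y) ⊠ z) ≅ as x y z ≫ as' x y z :=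
  isoApp (TensorData.assoc (L := L)).unit (x, y, z)

def asCounit (x y z : L) : as' x y z ≫ as x y z ≅ 𝟙 (x ⊠ y ⊠ z) :=
  isoApp (TensorData.assoc (L := L)).counit (x, y, z)

/-- Naturality of the associator in each of the variables. -/
def asNat₁ {x x' : L} (f : x ⟶ x') (y z : L) :
    (f ▹ y) ▹ z ≫ as x' y z ≅ as x y z ≫ f ▹ (y ⊠ z) :=
  (TensorData.assoc (L := L)).hom.naturality (a := (x, y, z)) (b := (x', y, z)) (f, 𝟙 y, 𝟙 z) ≪≫
    whiskerLeftIso _ (tIso (Iso.refl f) (tId y z))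

def asNat₂ (x : L) {y y' : L} (f : y ⟶ y') (z : L) :
    (x ◃ f) ▹ z ≫ as x y' z ≅ as x y z ≫ x ◃ (f ▹ z) :=
  (TensorData.assoc (L := L)).hom.naturality (a := (x, y, z)) (b := (x, y', z)) (𝟙 x, f, 𝟙 z)

def asNat₃ (x y : L) {z z' : L} (f : z ⟶ z') :
    (x ⊠ y) ◃ f ≫ as x y z' ≅ as x y z ≫ x ◃ (y ◃ f) :=
  whiskerRightIso (tIso (tId x y).symm (Iso.refl f)) _ ≪≫
    (TensorData.assoc (L := L)).hom.naturality (a := (x, y, z)) (b := (x, y, z')) (𝟙 x, 𝟙 y, f)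

def asNat₁' {x x' : L} (f : x ⟶ x') (y z : L) :
    f ▹ (y ⊠ z) ≫ as' x' y z ≅ as' x y z ≫ (f ▹ y) ▹ z :=
  whiskerRightIso (tIso (Iso.refl f) (tId y z).symm) _ ≪≫
    (TensorData.assoc (L := L)).inv.naturality (a := (x, y, z)) (b := (x', y, z)) (f, 𝟙 y, 𝟙 z)

def asNat₃' (x y : L) {z z' : L} (f : z ⟶ z') :
    x ◃ (y ◃ f) ≫ as' x y z' ≅ as' x y z ≫ (x ⊠ y) ◃ f :=
  (TensorData.assoc (L := L)).inv.naturality (a := (x, y, z)) (b := (x, y, z')) (𝟙 x, 𝟙 y, f) ≪≫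
    whiskerLeftIso _ (tIso (tId x y) (Iso.refl f))

/-- Naturality of the unitors. -/
def luNat {x x' : L} (f : x ⟶ x') : unit L ◃ f ≫ lu x' ≅ lu x ≫ f :=
  (TensorData.leftUnit (L := L)).hom.naturality f

def ruNat {x x' : L} (f : x ⟶ x') : f ▹ unit L ≫ ru x' ≅ ru x ≫ f :=
  (TensorData.rightUnit (L := L)).hom.naturality f

end Tensor

local infixr:70 " ⊠ " => tobj
local infixl:81 " ▹ " => wr
local infixr:81 " ◃ " => wl

abbrev p₁ (L : Type u) [Bicategory.{w, v} L] : L × L × L × L ⥤ᵖ L := proj₁ L (L × L × L)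
abbrev p₂ (L : Type u) [Bicategory.{w, v} L] : L × L × L × L ⥤ᵖ L :=
  (proj₂ L (L × L × L)).comp (q₁ L)
abbrev p₃ (L : Type u) [Bicategory.{w, v} L] : L × L × L × L ⥤ᵖ L :=
  (proj₂ L (L × L × L)).comp (q₂ L)
abbrev p₄ (L : Type u) [Bicategory.{w, v} L] : L × L × L × L ⥤ᵖ L :=
  (proj₂ L (L × L × L)).comp (q₃ L)

/-- The invertible modifications of a monoidal bicategory: the pentagonator and the three
2-unitors. -/
class MonoidalModifications (L : Type u) [Bicategory.{w, v} L] extends TensorData L where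
  pentagonator :
    tnR (aT (p₁ L) (p₂ L) (p₃ L)) (p₄ L) ≫ aT (p₁ L) (tn (p₂ L) (p₃ L)) (p₄ L) ≫
        tnL (p₁ L) (aT (p₂ L) (p₃ L) (p₄ L)) ≅
      aT (tn (p₁ L) (p₂ L)) (p₃ L) (p₄ L) ≫ aT (p₁ L) (p₂ L) (tn (p₃ L) (p₄ L))
  middleUnitor :
    aT (proj₁ L L) (one _ L) (proj₂ L L) ≫ tnL (proj₁ L L) (lT (proj₂ L L)) ≅
      tnR (rT (proj₁ L L)) (proj₂ L L)
  leftUnitor₂ :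
    tnR (lT (proj₁ L L)) (proj₂ L L) ≅
      aT (one _ L) (proj₁ L L) (proj₂ L L) ≫ lT (tn (proj₁ L L) (proj₂ L L))
  rightUnitor₂ :
    aT (proj₁ L L) (proj₂ L L) (one _ L) ≫ tnL (proj₁ L L) (rT (proj₂ L L)) ≅
      rT (tn (proj₁ L L) (proj₂ L L))

section

variable [MonoidalModifications L]

/-- The components of the pentagonator. -/
def pent (x y z t : L) :
    as x y z ▹ t ≫ as x (y ⊠ z) t ≫ x ◃ as y z t ≅ as (x ⊠ y) z t ≫ as x y (z ⊠ t) :=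
  isoApp (MonoidalModifications.pentagonator (L := L)) (x, y, z, t)

def mid (x y : L) : as x (unit L) y ≫ x ◃ lu y ≅ ru x ▹ y :=
  isoApp (MonoidalModifications.middleUnitor (L := L)) (x, y)

def lu₂ (x y : L) : lu x ▹ y ≅ as (unit L) x y ≫ lu (x ⊠ y) :=
  isoApp (MonoidalModifications.leftUnitor₂ (L := L)) (x, y)

def ru₂ (x y : L) : as x y (unit L) ≫ x ◃ ru y ≅ ru (x ⊠ y) :=
  isoApp (MonoidalModifications.rightUnitor₂ (L := L)) (x, y)

/-- Cancellation of an associator and its inverse inside a tensor product. -/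
def wrCounit (x y z t : L) : as' x y z ▹ t ≫ as x y z ▹ t ≅ 𝟙 ((x ⊠ y ⊠ z) ⊠ t) :=
  (wrComp (as' x y z) (as x y z) t).symm ≪≫ wrIso (asCounit x y z) t ≪≫ tId _ _

def wlCounit (t x y z : L) : t ◃ as' x y z ≫ t ◃ as x y z ≅ 𝟙 (t ⊠ x ⊠ y ⊠ z) :=
  (wlComp t (as' x y z) (as x y z)).symm ≪≫ wlIso t (asCounit x y z) ≪≫ tId _ _

def wrUnit (x y z t : L) : 𝟙 (((x ⊠ y) ⊠ z) ⊠ t) ≅ as x y z ▹ t ≫ as' x y z ▹ t :=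
  (tId _ _).symm ≪≫ wrIso (asUnit x y z) t ≪≫ wrComp (as x y z) (as' x y z) t

def wlUnit (t x y z : L) : 𝟙 (t ⊠ (x ⊠ y) ⊠ z) ≅ t ◃ as x y z ≫ t ◃ as' x y z :=
  (tId _ _).symm ≪≫ wlIso t (asUnit x y z) ≪≫ wlComp t (as x y z) (as' x y z)

/-- The pentagonator and the 2-unitors inside a tensor product. -/
def wrPent (x y z t s : L) :
    (as x y z ▹ t) ▹ s ≫ as x (y ⊠ z) t ▹ s ≫ (x ◃ as y z t) ▹ s ≅
      as (x ⊠ y) z t ▹ s ≫ as x y (z ⊠ t) ▹ s :=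
  (wrComp₃ (as x y z ▹ t) (as x (y ⊠ z) t) (x ◃ as y z t) s).symm ≪≫
    wrIso (pent x y z t) s ≪≫ wrComp (as (x ⊠ y) z t) (as x y (z ⊠ t)) s

def wlPent (s x y z t : L) :
    s ◃ (as x y z ▹ t) ≫ s ◃ as x (y ⊠ z) t ≫ s ◃ (x ◃ as y z t) ≅
      s ◃ as (x ⊠ y) z t ≫ s ◃ as x y (z ⊠ t) :=
  (wlComp₃ s (as x y z ▹ t) (as x (y ⊠ z) t) (x ◃ as y z t)).symm ≪≫
    wlIso s (pent x y z t) ≪≫ wlComp s (as (x ⊠ y) z t) (as x y (z ⊠ t))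

def wrMid (x y z : L) :
    as x (unit L) y ▹ z ≫ (x ◃ lu y) ▹ z ≅ (ru x ▹ y) ▹ z :=
  (wrComp (as x (unit L) y) (x ◃ lu y) z).symm ≪≫ wrIso (mid x y) z

def wlMid (x y z : L) :
    x ◃ as y (unit L) z ≫ x ◃ (y ◃ lu z) ≅ x ◃ (ru y ▹ z) :=
  (wlComp x (as y (unit L) z) (y ◃ lu z)).symm ≪≫ wlIso x (mid y z)

def wlLu₂ (x y z : L) : x ◃ (lu y ▹ z) ≅ x ◃ as (unit L) y z ≫ x ◃ lu (y ⊠ z) :=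
  wlIso x (lu₂ y z) ≪≫ wlComp x (as (unit L) y z) (lu (y ⊠ z))

def wrRu₂ (x y z : L) : as x y (unit L) ▹ z ≫ (x ◃ ru y) ▹ z ≅ ru (x ⊠ y) ▹ z :=
  (wrComp (as x y (unit L)) (x ◃ ru y) z).symm ≪≫ wrIso (ru₂ x y) z

/-- The two sides of the associahedron. -/
def assocL (s x y z t : L) :
    (as s x y ▹ z) ▹ t ≫ as s (x ⊠ y) z ▹ t ≫ as s ((x ⊠ y) ⊠ z) t ≫ s ◃ (as x y z ▹ t) ≫
        s ◃ as x (y ⊠ z) t ≫ s ◃ (x ◃ as y z t) ⟶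
      as ((s ⊠ x) ⊠ y) z t ≫ as (s ⊠ x) y (z ⊠ t) ≫ as s x (y ⊠ z ⊠ t) :=
  𝟙 _ ⊗≫ ((as s x y ▹ z) ▹ t) ◁ (as s (x ⊠ y) z ▹ t) ◁ as s ((x ⊠ y) ⊠ z) t ◁
      (wlPent s x y z t).hom ⊗≫
    ((as s x y ▹ z) ▹ t) ◁ (pent s (x ⊠ y) z t).hom ▷ (s ◃ as x y (z ⊠ t)) ⊗≫
    (asNat₁ (as s x y) z t).hom ▷ (as s (x ⊠ y) (z ⊠ t) ≫ s ◃ as x y (z ⊠ t)) ⊗≫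
    as ((s ⊠ x) ⊠ y) z t ◁ (pent s x y (z ⊠ t)).hom ⊗≫ 𝟙 _

def assocR (s x y z t : L) :
    (as s x y ▹ z) ▹ t ≫ as s (x ⊠ y) z ▹ t ≫ as s ((x ⊠ y) ⊠ z) t ≫ s ◃ (as x y z ▹ t) ≫
        s ◃ as x (y ⊠ z) t ≫ s ◃ (x ◃ as y z t) ⟶
      as ((s ⊠ x) ⊠ y) z t ≫ as (s ⊠ x) y (z ⊠ t) ≫ as s x (y ⊠ z ⊠ t) :=
  𝟙 _ ⊗≫ ((as s x y ▹ z) ▹ t) ◁ (as s (x ⊠ y) z ▹ t) ◁ (asNat₂ s (as x y z) t).inv ▷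
      (s ◃ as x (y ⊠ z) t ≫ s ◃ (x ◃ as y z t)) ⊗≫
    (wrPent s x y z t).hom ▷ (as s (x ⊠ y ⊠ z) t ≫ s ◃ as x (y ⊠ z) t ≫
      s ◃ (x ◃ as y z t)) ⊗≫
    (as (s ⊠ x) y z ▹ t) ◁ (pent s x (y ⊠ z) t).hom ▷ (s ◃ (x ◃ as y z t)) ⊗≫
    (as (s ⊠ x) y z ▹ t) ◁ as (s ⊠ x) (y ⊠ z) t ◁ (asNat₃ s x (as y z t)).inv ⊗≫
    (pent (s ⊠ x) y z t).hom ▷ as s x (y ⊠ z ⊠ t) ⊗≫ 𝟙 _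

/-- The two sides of the coherence condition for a unit in the second of four positions. -/
def secondL (x y z : L) :
    as x (unit L) y ▹ z ≫ as x (unit L ⊠ y) z ≫ x ◃ (lu y ▹ z) ⟶
      (ru x ▹ y) ▹ z ≫ as x y z :=
  𝟙 _ ⊗≫ (as x (unit L) y ▹ z) ◁ (asNat₂ x (lu y) z).inv ⊗≫
    (wrMid x y z).hom ▷ as x y z ⊗≫ 𝟙 _

def secondR (x y z : L) :
    as x (unit L) y ▹ z ≫ as x (unit L ⊠ y) z ≫ x ◃ (lu y ▹ z) ⟶
      (ru x ▹ y) ▹ z ≫ as x y z :=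
  𝟙 _ ⊗≫ (as x (unit L) y ▹ z) ◁ as x (unit L ⊠ y) z ◁ (wlLu₂ x y z).hom ⊗≫
    (pent x (unit L) y z).hom ▷ (x ◃ lu (y ⊠ z)) ⊗≫
    as (x ⊠ unit L) y z ◁ (mid x (y ⊠ z)).hom ⊗≫
    (asNat₁ (ru x) y z).inv ⊗≫ 𝟙 _

/-- The two sides of the coherence condition for a unit in the third of four positions. -/
def thirdL (x y z : L) :
    as x y (unit L) ▹ z ≫ as x (y ⊠ unit L) z ≫ x ◃ as y (unit L) z ≫ x ◃ (y ◃ lu z) ⟶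
      ru (x ⊠ y) ▹ z ≫ as x y z :=
  𝟙 _ ⊗≫ (as x y (unit L) ▹ z) ◁ as x (y ⊠ unit L) z ◁ (wlMid x y z).hom ⊗≫
    (as x y (unit L) ▹ z) ◁ (asNat₂ x (ru y) z).inv ⊗≫
    (wrRu₂ x y z).hom ▷ as x y z ⊗≫ 𝟙 _

def thirdR (x y z : L) :
    as x y (unit L) ▹ z ≫ as x (y ⊠ unit L) z ≫ x ◃ as y (unit L) z ≫ x ◃ (y ◃ lu z) ⟶
      ru (x ⊠ y) ▹ z ≫ as x y z :=
  𝟙 _ ⊗≫ (pent x y (unit L) z).hom ▷ (x ◃ (y ◃ lu z)) ⊗≫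
    as (x ⊠ y) (unit L) z ◁ (asNat₃ x y (lu z)).inv ⊗≫
    (mid (x ⊠ y) z).hom ▷ as x y z ⊗≫ 𝟙 _

end

/-- A monoidal bicategory. -/
class MonoidalBicategory (L : Type u) [Bicategory.{w, v} L] extends
    MonoidalModifications L where
  associahedron (s x y z t : L) : assocL s x y z t = assocR s x y z t
  unit_second (x y z : L) : secondL x y z = secondR x y z
  unit_third (x y z : L) : thirdL x y z = thirdR x y z

/-! ### Braidings -/

section Hexagons

variable [MonoidalBicategory L]

/-- A family `b x y : x ⊗ y ⟶ y ⊗ x`, natural in the second variable, with hexagonators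
`b x y ⊗ z ≫ α ≫ y ⊗ b x z ≅ α ≫ b x (y ⊗ z) ≫ α`. -/
structure HexData (L : Type u) [Bicategory.{w, v} L] [MonoidalBicategory L] where
  b (x y : L) : x ⊠ y ⟶ y ⊠ x
  nat (x : L) {y y' : L} (f : y ⟶ y') : x ◃ f ≫ b x y' ≅ b x y ≫ f ▹ x
  hex (x y z : L) :
    b x y ▹ z ≫ as y x z ≫ y ◃ b x z ≅ as x y z ≫ b x (y ⊠ z) ≫ as y z x

namespace HexData

variable (h : HexData L)

def wrHex (x y z t : L) :
    (h.b x y ▹ z) ▹ t ≫ as y x z ▹ t ≫ (y ◃ h.b x z) ▹ t ≅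
      as x y z ▹ t ≫ h.b x (y ⊠ z) ▹ t ≫ as y z x ▹ t :=
  (wrComp₃ (h.b x y ▹ z) (as y x z) (y ◃ h.b x z) t).symm ≪≫ wrIso (h.hex x y z) t ≪≫
    wrComp₃ (as x y z) (h.b x (y ⊠ z)) (as y z x) t

def wlHex (t x y z : L) :
    t ◃ (h.b x y ▹ z) ≫ t ◃ as y x z ≫ t ◃ (y ◃ h.b x z) ≅
      t ◃ as x y z ≫ t ◃ h.b x (y ⊠ z) ≫ t ◃ as y z x :=
  (wlComp₃ t (h.b x y ▹ z) (as y x z) (y ◃ h.b x z)).symm ≪≫ wlIso t (h.hex x y z) ≪≫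
    wlComp₃ t (as x y z) (h.b x (y ⊠ z)) (as y z x)

/-- The two ways of moving `x` past `y ⊗ z ⊗ t`. -/
def crossL (x y z t : L) :
    (h.b x y ▹ z) ▹ t ≫ as y x z ▹ t ≫ (y ◃ h.b x z) ▹ t ≫ as y (z ⊠ x) t ≫ y ◃ as z x t ≫
        y ◃ (z ◃ h.b x t) ⟶
      as (x ⊠ y) z t ≫ as x y (z ⊠ t) ≫ h.b x (y ⊠ z ⊠ t) ≫ as y (z ⊠ t) x ≫ y ◃ as z t x :=
  𝟙 _ ⊗≫ (h.wrHex x y z t).hom ▷ (as y (z ⊠ x) t ≫ y ◃ as z x t ≫ y ◃ (z ◃ h.b x t)) ⊗≫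
    (as x y z ▹ t) ◁ (h.b x (y ⊠ z) ▹ t) ◁ (pent y z x t).hom ▷ (y ◃ (z ◃ h.b x t)) ⊗≫
    (as x y z ▹ t) ◁ (h.b x (y ⊠ z) ▹ t) ◁ as (y ⊠ z) x t ◁ (asNat₃ y z (h.b x t)).inv ⊗≫
    (as x y z ▹ t) ◁ (h.hex x (y ⊠ z) t).hom ▷ as y z (t ⊠ x) ⊗≫
    (as x y z ▹ t) ◁ as x (y ⊠ z) t ◁ h.b x ((y ⊠ z) ⊠ t) ◁ (pent y z t x).inv ⊗≫
    (as x y z ▹ t) ◁ as x (y ⊠ z) t ◁ (h.nat x (as y z t)).inv ▷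
      (as y (z ⊠ t) x ≫ y ◃ as z t x) ⊗≫
    (pent x y z t).hom ▷ (h.b x (y ⊠ z ⊠ t) ≫ as y (z ⊠ t) x ≫ y ◃ as z t x) ⊗≫ 𝟙 _

def crossR (x y z t : L) :
    (h.b x y ▹ z) ▹ t ≫ as y x z ▹ t ≫ (y ◃ h.b x z) ▹ t ≫ as y (z ⊠ x) t ≫ y ◃ as z x t ≫
        y ◃ (z ◃ h.b x t) ⟶
      as (x ⊠ y) z t ≫ as x y (z ⊠ t) ≫ h.b x (y ⊠ z ⊠ t) ≫ as y (z ⊠ t) x ≫ y ◃ as z t x :=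
  𝟙 _ ⊗≫ ((h.b x y ▹ z) ▹ t) ◁ (as y x z ▹ t) ◁ (asNat₂ y (h.b x z) t).hom ▷
      (y ◃ as z x t ≫ y ◃ (z ◃ h.b x t)) ⊗≫
    ((h.b x y ▹ z) ▹ t) ◁ (as y x z ▹ t) ◁ as y (x ⊠ z) t ◁ (h.wlHex y x z t).hom ⊗≫
    ((h.b x y ▹ z) ▹ t) ◁ (pent y x z t).hom ▷ (y ◃ h.b x (z ⊠ t) ≫ y ◃ as z t x) ⊗≫
    (asNat₁ (h.b x y) z t).hom ▷ (as y x (z ⊠ t) ≫ y ◃ h.b x (z ⊠ t) ≫ y ◃ as z t x) ⊗≫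
    as (x ⊠ y) z t ◁ (h.hex x y (z ⊠ t)).hom ▷ (y ◃ as z t x) ⊗≫ 𝟙 _

end HexData

end Hexagons

/-- A braiding: an adjoint equivalence `x ⊗ y ≌ y ⊗ x` of pseudofunctors. -/
class BraidingData (L : Type u) [Bicategory.{w, v} L] [MonoidalBicategory L] where
  braid : tn (proj₁ L L) (proj₂ L L) ≌ tn (proj₂ L L) (proj₁ L L)

section

variable [MonoidalBicategory L] [BraidingData L]

abbrev bT (F G : X ⥤ᵖ L) : tn F G ⟶ tn G F := braidAt BraidingData.braid.hom F G

/-- The transformation with components the inverses of `b y x : y ⊗ x ⟶ x ⊗ y`. -/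
abbrev bRevT (F G : X ⥤ᵖ L) : tn F G ⟶ tn G F := braidRevAt BraidingData.braid.inv F G

abbrev br (x y : L) : x ⊠ y ⟶ y ⊠ x := (BraidingData.braid (L := L)).hom.app (x, y)

/-- The inverse of `br x y`. -/
abbrev br' (x y : L) : y ⊠ x ⟶ x ⊠ y := (BraidingData.braid (L := L)).inv.app (x, y)

def brUnit (x y : L) : 𝟙 (x ⊠ y) ≅ br x y ≫ br' x y :=
  isoApp (BraidingData.braid (L := L)).unit (x, y)

def brCounit (x y : L) : br' x y ≫ br x y ≅ 𝟙 (y ⊠ x) :=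
  isoApp (BraidingData.braid (L := L)).counit (x, y)

def brNat₁ {x x' : L} (f : x ⟶ x') (y : L) : f ▹ y ≫ br x' y ≅ br x y ≫ y ◃ f :=
  (BraidingData.braid (L := L)).hom.naturality (a := (x, y)) (b := (x', y)) (f, 𝟙 y)

def brNat₂ (x : L) {y y' : L} (f : y ⟶ y') : x ◃ f ≫ br x y' ≅ br x y ≫ f ▹ x :=
  (BraidingData.braid (L := L)).hom.naturality (a := (x, y)) (b := (x, y')) (𝟙 x, f)

/-- Naturality of the inverse braiding, in each of the variables. -/
def brNat₁' {x x' : L} (f : x ⟶ x') (y : L) : y ◃ f ≫ br' x' y ≅ br' x y ≫ f ▹ y :=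
  (BraidingData.braid (L := L)).inv.naturality (a := (x, y)) (b := (x', y)) (f, 𝟙 y)

def brNat₂' (x : L) {y y' : L} (f : y ⟶ y') : f ▹ x ≫ br' x y' ≅ br' x y ≫ x ◃ f :=
  (BraidingData.braid (L := L)).inv.naturality (a := (x, y)) (b := (x, y')) (𝟙 x, f)

def wrBrCounit (x y z : L) : br' x y ▹ z ≫ br x y ▹ z ≅ 𝟙 ((y ⊠ x) ⊠ z) :=
  (wrComp (br' x y) (br x y) z).symm ≪≫ wrIso (brCounit x y) z ≪≫ tId _ _

def wlBrCounit (z x y : L) : z ◃ br' x y ≫ z ◃ br x y ≅ 𝟙 (z ⊠ y ⊠ x) :=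
  (wlComp z (br' x y) (br x y)).symm ≪≫ wlIso z (brCounit x y) ≪≫ tId _ _

end

/-- The hexagonators of a braiding, as invertible modifications. -/
class Hexagonators (L : Type u) [Bicategory.{w, v} L] [MonoidalBicategory L] extends
    BraidingData L where
  hexR :
    tnR (bT (q₁ L) (q₂ L)) (q₃ L) ≫ aT (q₂ L) (q₁ L) (q₃ L) ≫ tnL (q₂ L) (bT (q₁ L) (q₃ L)) ≅
      aT (q₁ L) (q₂ L) (q₃ L) ≫ bT (q₁ L) (tn (q₂ L) (q₃ L)) ≫ aT (q₂ L) (q₃ L) (q₁ L)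
  hexS :
    aT' (q₁ L) (q₂ L) (q₃ L) ≫ bT (tn (q₁ L) (q₂ L)) (q₃ L) ≫ aT' (q₃ L) (q₁ L) (q₂ L) ≅
      tnL (q₁ L) (bT (q₂ L) (q₃ L)) ≫ aT' (q₁ L) (q₃ L) (q₂ L) ≫
        tnR (bT (q₁ L) (q₃ L)) (q₂ L)

section

variable [MonoidalBicategory L] [Hexagonators L]

def hR (x y z : L) :
    br x y ▹ z ≫ as y x z ≫ y ◃ br x z ≅ as x y z ≫ br x (y ⊠ z) ≫ as y z x :=
  isoApp (Hexagonators.hexR (L := L)) (x, y, z)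

def hS (x y z : L) :
    as' x y z ≫ br (x ⊠ y) z ≫ as' z x y ≅ x ◃ br y z ≫ as' x z y ≫ br x z ▹ y :=
  isoApp (Hexagonators.hexS (L := L)) (x, y, z)

/-- The hexagonator `hS`, solved for the braiding of `x ⊗ y` with `z`. -/
def hS' (x y z : L) :
    as x y z ≫ x ◃ br y z ≫ as' x z y ≫ br x z ▹ y ≫ as z x y ≅ br (x ⊠ y) z :=
  Iso.refl _ ≪⊗≫
    whiskerLeftIso (as x y z) (whiskerRightIso (hS x y z).symm (as z x y)) ≪⊗≫
    whiskerRightIso (asUnit x y z).symm (br (x ⊠ y) z ≫ as' z x y ≫ as z x y) ≪⊗≫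
    whiskerLeftIso (br (x ⊠ y) z) (asCounit z x y) ≪⊗≫ Iso.refl _

/-- The mate of `hS`: a hexagonator for the reverse braiding `br' y x : x ⊗ y ⟶ y ⊗ x`. -/
def hSRev (z x y : L) :
    br' x z ▹ y ≫ as x z y ≫ x ◃ br' y z ≅ as z x y ≫ br' (x ⊠ y) z ≫ as x y z :=
  Iso.refl _ ≪⊗≫
    whiskerLeftIso (br' x z ▹ y ≫ as x z y ≫ x ◃ br' y z) (asCounit x y z).symm ≪⊗≫
    whiskerLeftIso (br' x z ▹ y ≫ as x z y ≫ x ◃ br' y z ≫ as' x y z)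
      (whiskerRightIso (brUnit (x ⊠ y) z) (as x y z)) ≪⊗≫
    whiskerLeftIso (br' x z ▹ y ≫ as x z y ≫ x ◃ br' y z ≫ as' x y z)
      (whiskerRightIso (hS' x y z).symm (br' (x ⊠ y) z ≫ as x y z)) ≪⊗≫
    whiskerLeftIso (br' x z ▹ y ≫ as x z y ≫ x ◃ br' y z)
      (whiskerRightIso (asCounit x y z)
        (x ◃ br y z ≫ as' x z y ≫ br x z ▹ y ≫ as z x y ≫ br' (x ⊠ y) z ≫ as x y z)) ≪⊗≫
    whiskerLeftIso (br' x z ▹ y ≫ as x z y)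
      (whiskerRightIso (wlBrCounit x y z)
        (as' x z y ≫ br x z ▹ y ≫ as z x y ≫ br' (x ⊠ y) z ≫ as x y z)) ≪⊗≫
    whiskerLeftIso (br' x z ▹ y) (whiskerRightIso (asUnit x z y).symm
        (br x z ▹ y ≫ as z x y ≫ br' (x ⊠ y) z ≫ as x y z)) ≪⊗≫
    whiskerRightIso (wrBrCounit x z y) (as z x y ≫ br' (x ⊠ y) z ≫ as x y z) ≪⊗≫ Iso.refl _

/-- The braiding, and the reverse braiding, with their hexagonators. -/
def forward (L : Type u) [Bicategory.{w, v} L] [MonoidalBicategory L] [Hexagonators L] :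
    HexData L where
  b := br
  nat := brNat₂
  hex := hR

def backward (L : Type u) [Bicategory.{w, v} L] [MonoidalBicategory L] [Hexagonators L] :
    HexData L where
  b x y := br' y x
  nat x _ _ f := brNat₁' f x
  hex := hSRev

def wrHR (x y z t : L) :
    (br x y ▹ z) ▹ t ≫ as y x z ▹ t ≫ (y ◃ br x z) ▹ t ≅
      as x y z ▹ t ≫ br x (y ⊠ z) ▹ t ≫ as y z x ▹ t :=
  (forward L).wrHex x y z t

def wlHR (t x y z : L) :
    t ◃ (br x y ▹ z) ≫ t ◃ as y x z ≫ t ◃ (y ◃ br x z) ≅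
      t ◃ as x y z ≫ t ◃ br x (y ⊠ z) ≫ t ◃ as y z x :=
  (forward L).wlHex t x y z

def wrS (x y z t : L) :
    as x y z ▹ t ≫ (x ◃ br y z) ▹ t ≫ as' x z y ▹ t ≫ (br x z ▹ y) ▹ t ≫ as z x y ▹ t ≅
      br (x ⊠ y) z ▹ t :=
  (wrComp₅ (as x y z) (x ◃ br y z) (as' x z y) (br x z ▹ y) (as z x y) t).symm ≪≫
    wrIso (hS' x y z) t

def wlS (t x y z : L) :
    t ◃ as x y z ≫ t ◃ (x ◃ br y z) ≫ t ◃ as' x z y ≫ t ◃ (br x z ▹ y) ≫ t ◃ as z x y ≅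
      t ◃ br (x ⊠ y) z :=
  (wlComp₅ t (as x y z) (x ◃ br y z) (as' x z y) (br x z ▹ y) (as z x y)).symm ≪≫
    wlIso t (hS' x y z)

/-- The two ways of reversing `x ⊗ y ⊗ z`. -/
def reverseL (x y z : L) :
    br x y ▹ z ≫ as y x z ≫ y ◃ br x z ≫ as' y z x ≫ br y z ▹ x ≫ as z y x ⟶
      as x y z ≫ x ◃ br y z ≫ as' x z y ≫ br x z ▹ y ≫ as z x y ≫ z ◃ br x y :=
  𝟙 _ ⊗≫ (hR x y z).hom ▷ (as' y z x ≫ br y z ▹ x ≫ as z y x) ⊗≫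
    as x y z ◁ br x (y ⊠ z) ◁ (asUnit y z x).inv ▷ (br y z ▹ x ≫ as z y x) ⊗≫
    as x y z ◁ (brNat₂ x (br y z)).inv ▷ as z y x ⊗≫
    as x y z ◁ (x ◃ br y z) ◁ (asCounit x z y).inv ▷ (br x (z ⊠ y) ≫ as z y x) ⊗≫
    as x y z ◁ (x ◃ br y z) ◁ as' x z y ◁ (hR x z y).inv ⊗≫ 𝟙 _

def reverseR (x y z : L) :
    br x y ▹ z ≫ as y x z ≫ y ◃ br x z ≫ as' y z x ≫ br y z ▹ x ≫ as z y x ⟶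
      as x y z ≫ x ◃ br y z ≫ as' x z y ≫ br x z ▹ y ≫ as z x y ≫ z ◃ br x y :=
  𝟙 _ ⊗≫ (br x y ▹ z) ◁ (hS' y x z).hom ⊗≫ (brNat₁ (br x y) z).hom ⊗≫
    (hS' x y z).inv ▷ (z ◃ br x y) ⊗≫ 𝟙 _

/-- Three reassociations used in the comparison below, obtained from the pentagonator by
cancelling associators with their inverses. -/
def moveP (x y z t : L) :
    as' x y z ▹ t ≫ as (x ⊠ y) z t ≅ as x (y ⊠ z) t ≫ x ◃ as y z t ≫ as' x y (z ⊠ t) :=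
  Iso.refl _ ≪⊗≫
    whiskerLeftIso (as' x y z ▹ t ≫ as (x ⊠ y) z t) (asUnit x y (z ⊠ t)) ≪⊗≫
    whiskerLeftIso (as' x y z ▹ t) (whiskerRightIso (pent x y z t).symm (as' x y (z ⊠ t))) ≪⊗≫
    whiskerRightIso (wrCounit x y z t)
      (as x (y ⊠ z) t ≫ x ◃ as y z t ≫ as' x y (z ⊠ t)) ≪⊗≫ Iso.refl _

def moveU (x y z t : L) :
    as x y (z ⊠ t) ≫ x ◃ as' y z t ≅ as' (x ⊠ y) z t ≫ as x y z ▹ t ≫ as x (y ⊠ z) t :=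
  Iso.refl _ ≪⊗≫
    whiskerRightIso (asCounit (x ⊠ y) z t).symm (as x y (z ⊠ t) ≫ x ◃ as' y z t) ≪⊗≫
    whiskerLeftIso (as' (x ⊠ y) z t) (whiskerRightIso (pent x y z t).symm (x ◃ as' y z t)) ≪⊗≫
    whiskerLeftIso (as' (x ⊠ y) z t ≫ as x y z ▹ t ≫ as x (y ⊠ z) t)
      (wlUnit x y z t).symm ≪⊗≫ Iso.refl _

def moveV (x y z t : L) :
    x ◃ as' y z t ≫ as' x (y ⊠ z) t ≫ as' x y z ▹ t ≅ as' x y (z ⊠ t) ≫ as' (x ⊠ y) z t :=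
  Iso.refl _ ≪⊗≫
    whiskerRightIso (asCounit x y (z ⊠ t)).symm
      (x ◃ as' y z t ≫ as' x (y ⊠ z) t ≫ as' x y z ▹ t) ≪⊗≫
    whiskerLeftIso (as' x y (z ⊠ t)) (whiskerRightIso (asCounit (x ⊠ y) z t).symm
      (as x y (z ⊠ t) ≫ x ◃ as' y z t ≫ as' x (y ⊠ z) t ≫ as' x y z ▹ t)) ≪⊗≫
    whiskerLeftIso (as' x y (z ⊠ t) ≫ as' (x ⊠ y) z t) (whiskerRightIso (pent x y z t).symm
      (x ◃ as' y z t ≫ as' x (y ⊠ z) t ≫ as' x y z ▹ t)) ≪⊗≫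
    whiskerLeftIso (as' x y (z ⊠ t) ≫ as' (x ⊠ y) z t ≫ as x y z ▹ t ≫ as x (y ⊠ z) t)
      (whiskerRightIso (wlUnit x y z t).symm (as' x (y ⊠ z) t ≫ as' x y z ▹ t)) ≪⊗≫
    whiskerLeftIso (as' x y (z ⊠ t) ≫ as' (x ⊠ y) z t ≫ as x y z ▹ t)
      (whiskerRightIso (asUnit x (y ⊠ z) t).symm (as' x y z ▹ t)) ≪⊗≫
    whiskerLeftIso (as' x y (z ⊠ t) ≫ as' (x ⊠ y) z t) (wrUnit x y z t).symm ≪⊗≫ Iso.refl _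

/-- The two ways of moving `x ⊗ y` past `z ⊗ t`: first with all crossings of `z`, then with all
crossings of `t`; or first with all crossings of `y`, then with all crossings of `x`. -/
def exchangeL (x y z t : L) :
    as x y z ▹ t ≫ (x ◃ br y z) ▹ t ≫ as' x z y ▹ t ≫ (br x z ▹ y) ▹ t ≫ as z x y ▹ t ≫
        as z (x ⊠ y) t ≫ z ◃ as x y t ≫ z ◃ (x ◃ br y t) ≫ z ◃ as' x t y ≫
        z ◃ (br x t ▹ y) ≫ z ◃ as t x y ⟶
      as (x ⊠ y) z t ≫ br (x ⊠ y) (z ⊠ t) ≫ as z t (x ⊠ y) :=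
  𝟙 _ ⊗≫ (wrS x y z t).hom ▷ (as z (x ⊠ y) t ≫ z ◃ as x y t ≫ z ◃ (x ◃ br y t) ≫
        z ◃ as' x t y ≫ z ◃ (br x t ▹ y) ≫ z ◃ as t x y) ⊗≫
    (br (x ⊠ y) z ▹ t) ◁ as z (x ⊠ y) t ◁ (wlS z x y t).hom ⊗≫
    (hR (x ⊠ y) z t).hom ⊗≫ 𝟙 _

def exchangeR (x y z t : L) :
    as x y z ▹ t ≫ (x ◃ br y z) ▹ t ≫ as' x z y ▹ t ≫ (br x z ▹ y) ▹ t ≫ as z x y ▹ t ≫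
        as z (x ⊠ y) t ≫ z ◃ as x y t ≫ z ◃ (x ◃ br y t) ≫ z ◃ as' x t y ≫
        z ◃ (br x t ▹ y) ≫ z ◃ as t x y ⟶
      as (x ⊠ y) z t ≫ br (x ⊠ y) (z ⊠ t) ≫ as z t (x ⊠ y) :=
  𝟙 _ ⊗≫
    (as x y z ▹ t ≫ (x ◃ br y z) ▹ t ≫ as' x z y ▹ t ≫ (br x z ▹ y) ▹ t) ◁
      (pent z x y t).hom ▷ (z ◃ (x ◃ br y t) ≫ z ◃ as' x t y ≫ z ◃ (br x t ▹ y) ≫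
        z ◃ as t x y) ⊗≫
    (as x y z ▹ t ≫ (x ◃ br y z) ▹ t ≫ as' x z y ▹ t) ◁
      (asNat₁ (br x z) y t).hom ▷ (as z x (y ⊠ t) ≫ z ◃ (x ◃ br y t) ≫ z ◃ as' x t y ≫
        z ◃ (br x t ▹ y) ≫ z ◃ as t x y) ⊗≫
    (as x y z ▹ t ≫ (x ◃ br y z) ▹ t ≫ as' x z y ▹ t ≫ as (x ⊠ z) y t ≫
        br x z ▹ (y ⊠ t)) ◁ (asNat₃ z x (br y t)).inv ▷
      (z ◃ as' x t y ≫ z ◃ (br x t ▹ y) ≫ z ◃ as t x y) ⊗≫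
    (as x y z ▹ t ≫ (x ◃ br y z) ▹ t ≫ as' x z y ▹ t ≫ as (x ⊠ z) y t) ◁
      (inter (br x z) (br y t)).hom ▷ (as z x (t ⊠ y) ≫ z ◃ as' x t y ≫ z ◃ (br x t ▹ y) ≫
        z ◃ as t x y) ⊗≫
    (as x y z ▹ t ≫ (x ◃ br y z) ▹ t) ◁ (moveP x z y t).hom ▷
      ((x ⊠ z) ◃ br y t ≫ br x z ▹ (t ⊠ y) ≫ as z x (t ⊠ y) ≫ z ◃ as' x t y ≫
        z ◃ (br x t ▹ y) ≫ z ◃ as t x y) ⊗≫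
    (as x y z ▹ t) ◁ (asNat₂ x (br y z) t).hom ▷
      (x ◃ as z y t ≫ as' x z (y ⊠ t) ≫ (x ⊠ z) ◃ br y t ≫ br x z ▹ (t ⊠ y) ≫
        as z x (t ⊠ y) ≫ z ◃ as' x t y ≫ z ◃ (br x t ▹ y) ≫ z ◃ as t x y) ⊗≫
    (as x y z ▹ t ≫ as x (y ⊠ z) t ≫ x ◃ (br y z ▹ t) ≫ x ◃ as z y t) ◁
      (asNat₃' x z (br y t)).inv ▷ (br x z ▹ (t ⊠ y) ≫ as z x (t ⊠ y) ≫ z ◃ as' x t y ≫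
        z ◃ (br x t ▹ y) ≫ z ◃ as t x y) ⊗≫
    (as x y z ▹ t ≫ as x (y ⊠ z) t ≫ x ◃ (br y z ▹ t) ≫ x ◃ as z y t ≫ x ◃ (z ◃ br y t) ≫
        as' x z (t ⊠ y) ≫ br x z ▹ (t ⊠ y)) ◁ (moveU z x t y).hom ▷
      (z ◃ (br x t ▹ y) ≫ z ◃ as t x y) ⊗≫
    (as x y z ▹ t ≫ as x (y ⊠ z) t ≫ x ◃ (br y z ▹ t) ≫ x ◃ as z y t ≫ x ◃ (z ◃ br y t) ≫
        as' x z (t ⊠ y)) ◁ (asNat₁' (br x z) t y).hom ▷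
      (as z x t ▹ y ≫ as z (x ⊠ t) y ≫ z ◃ (br x t ▹ y) ≫ z ◃ as t x y) ⊗≫
    (as x y z ▹ t ≫ as x (y ⊠ z) t ≫ x ◃ (br y z ▹ t) ≫ x ◃ as z y t ≫ x ◃ (z ◃ br y t)) ◁
      (moveV x z t y).inv ▷ ((br x z ▹ t) ▹ y ≫ as z x t ▹ y ≫ as z (x ⊠ t) y ≫
        z ◃ (br x t ▹ y) ≫ z ◃ as t x y) ⊗≫
    (as x y z ▹ t ≫ as x (y ⊠ z) t ≫ x ◃ (br y z ▹ t) ≫ x ◃ as z y t ≫ x ◃ (z ◃ br y t) ≫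
        x ◃ as' z t y ≫ as' x (z ⊠ t) y ≫ as' x z t ▹ y ≫ (br x z ▹ t) ▹ y ≫ as z x t ▹ y) ◁
      (asNat₂ z (br x t) y).inv ▷ (z ◃ as t x y) ⊗≫
    (as x y z ▹ t ≫ as x (y ⊠ z) t) ◁ (wlHR x y z t).hom ▷
      (x ◃ as' z t y ≫ as' x (z ⊠ t) y ≫ as' x z t ▹ y ≫ (br x z ▹ t) ▹ y ≫ as z x t ▹ y ≫
        (z ◃ br x t) ▹ y ≫ as z (t ⊠ x) y ≫ z ◃ as t x y) ⊗≫
    (as x y z ▹ t ≫ as x (y ⊠ z) t ≫ x ◃ as y z t ≫ x ◃ br y (z ⊠ t)) ◁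
      (wlUnit x z t y).inv ▷ (as' x (z ⊠ t) y ≫ as' x z t ▹ y ≫ (br x z ▹ t) ▹ y ≫
        as z x t ▹ y ≫ (z ◃ br x t) ▹ y ≫ as z (t ⊠ x) y ≫ z ◃ as t x y) ⊗≫
    (pent x y z t).hom ▷ (x ◃ br y (z ⊠ t) ≫ as' x (z ⊠ t) y ≫ as' x z t ▹ y ≫
        (br x z ▹ t) ▹ y ≫ as z x t ▹ y ≫ (z ◃ br x t) ▹ y ≫ as z (t ⊠ x) y ≫
        z ◃ as t x y) ⊗≫
    (as (x ⊠ y) z t ≫ as x y (z ⊠ t) ≫ x ◃ br y (z ⊠ t) ≫ as' x (z ⊠ t) y ≫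
        as' x z t ▹ y) ◁ (wrHR x z t y).hom ▷
      (as z (t ⊠ x) y ≫ z ◃ as t x y) ⊗≫
    (as (x ⊠ y) z t ≫ as x y (z ⊠ t) ≫ x ◃ br y (z ⊠ t) ≫ as' x (z ⊠ t) y) ◁
      (wrCounit x z t y).hom ▷ (br x (z ⊠ t) ▹ y ≫ as z t x ▹ y ≫ as z (t ⊠ x) y ≫
        z ◃ as t x y) ⊗≫
    (as (x ⊠ y) z t ≫ as x y (z ⊠ t) ≫ x ◃ br y (z ⊠ t) ≫ as' x (z ⊠ t) y ≫
        br x (z ⊠ t) ▹ y) ◁ (pent z t x y).hom ⊗≫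
    as (x ⊠ y) z t ◁ (hS' x y (z ⊠ t)).hom ▷ as z t (x ⊠ y) ⊗≫ 𝟙 _

end

/-- A braided monoidal bicategory. -/
class BraidedBicategory (L : Type u) [Bicategory.{w, v} L] [MonoidalBicategory L] extends
    Hexagonators L where
  cross_forward (x y z t : L) : (forward L).crossL x y z t = (forward L).crossR x y z t
  cross_backward (x y z t : L) : (backward L).crossL x y z t = (backward L).crossR x y z t
  exchange (x y z t : L) : exchangeL x y z t = exchangeR x y z t
  reverse (x y z : L) : reverseL x y z = reverseR x y z

section Squares

variable {B : Type u₁} [Bicategory.{w₁, v₁} B] {F G : B ⥤ᵖ L}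

/-- The naturality square of a family of 2-morphisms `m a : η.app a ⟶ θ.app a` at `h`. -/
def Square (η θ : F ⟶ G) {a b : B}
    (ma : η.app a ⟶ θ.app a) (mb : η.app b ⟶ θ.app b) (h : a ⟶ b) : Prop :=
  F.map h ◁ mb ≫ (θ.naturality h).hom = (η.naturality h).hom ≫ ma ▷ G.map h

theorem Square.comp {η θ : F ⟶ G}
    {a b c : B} {ma : η.app a ⟶ θ.app a} {mb : η.app b ⟶ θ.app b} {mc : η.app c ⟶ θ.app c}
    {h : a ⟶ b} {k : b ⟶ c} (hh : Square η θ ma mb h) (hk : Square η θ mb mc k) :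
    Square η θ ma mc (h ≫ k) := by
  have e₁ := η.naturality_comp h k
  have e₂ := θ.naturality_comp h k
  unfold Square at *
  rw [← cancel_mono (θ.app a ◁ (G.mapComp h k).hom), assoc, e₂, whisker_exchange_assoc, assoc,
    ← whisker_exchange, reassoc_of% e₁]
  congr 1
  have hk' := congrArg (fun t => (α_ _ _ _).hom ≫ F.map h ◁ t ≫ (α_ _ _ _).inv ≫
    (θ.naturality h).hom ▷ G.map k ≫ (α_ _ _ _).hom) hk
  have hh' := congrArg (fun t => (α_ _ _ _).hom ≫ F.map h ◁ (η.naturality k).hom ≫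
    (α_ _ _ _).inv ≫ t ▷ G.map k ≫ (α_ _ _ _).hom) hh
  simp only [Bicategory.whiskerLeft_comp, comp_whiskerRight, assoc] at hk' hh'
  simp at hk' hh' ⊢
  rw [hk', hh']

theorem Square.iso {η θ : F ⟶ G} {a b : B} {ma : η.app a ⟶ θ.app a} {mb : η.app b ⟶ θ.app b}
    {h k : a ⟶ b} (hh : Square η θ ma mb h) (e : h ≅ k) : Square η θ ma mb k := by
  have e₁ := η.naturality_naturality e.hom
  have e₂ := θ.naturality_naturality e.hom
  unfold Square at *
  rw [← cancel_epi (F.map₂ e.hom ▷ η.app b), ← whisker_exchange_assoc, e₂, reassoc_of% hh,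
    reassoc_of% e₁, whisker_exchange]

end Squares

/-! ### The sylleptic centre -/

section

variable [MonoidalBicategory L] [BraidedBicategory L]

/-- A trivialization `v y : b x y ≅ (b y x)⁻¹` of the double braiding with `x`, natural in `y` and
compatible with the tensor product in the variable `y`. -/
structure HalfSyllepsis (x : L) where
  syl : bT (const L x) (Pseudofunctor.id L) ≅ bRevT (const L x) (Pseudofunctor.id L)
  mult (y z : L) :
    (hR x y z).hom ≫ as x y z ◁ (isoApp syl (y ⊠ z)).hom ▷ as y z x =
      (wr₂ (isoApp syl y).hom z ▷ (as y x z ≫ y ◃ br x z) ≫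
        (br' y x ▹ z) ◁ as y x z ◁ wl₂ y (isoApp syl z).hom) ≫ (hSRev x y z).hom

/-- The component `b x y ≅ (b y x)⁻¹` of a half-syllepsis. -/
def HalfSyllepsis.v {x : L} (s : HalfSyllepsis x) (y : L) : br x y ≅ br' y x := isoApp s.syl y

variable (L) in
/-- The objects of the sylleptic centre. -/
structure SyllepticCentre where
  obj : L
  half : HalfSyllepsis obj

/-- The condition on a 1-morphism `f : x ⟶ x'` to be a 1-morphism of the sylleptic centre: the
prism formed by `b f y`, `b y f`, `v y` and `v' y` commutes for all `y`. It is an equation of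
2-morphisms `f ⊗ y ≫ b x' y ⟶ (b y x)⁻¹ ≫ y ⊗ f`. -/
def central {x x' : L} (s : HalfSyllepsis x) (s' : HalfSyllepsis x') :
    ObjectProperty (x ⟶ x') := fun f =>
  ∀ y : L, (f ▹ y) ◁ (s'.v y).hom ≫ (brNat₂' y f).hom =
    (brNat₁ f y).hom ≫ (s.v y).hom ▷ (y ◃ f)

theorem central_iff {x x' : L} (s : HalfSyllepsis x) (s' : HalfSyllepsis x') (f : x ⟶ x') :
    central s s' f ↔ ∀ y : L, Square (F := tn (proj₁ L L) (proj₂ L L))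
      (G := tn (proj₂ L L) (proj₁ L L)) (bT (proj₁ L L) (proj₂ L L))
      (bRevT (proj₁ L L) (proj₂ L L)) (a := (x, y)) (b := (x', y))
      (s.v y).hom (s'.v y).hom (f, 𝟙 y) := Iff.rfl

theorem central_id {x : L} (s : HalfSyllepsis x) : central s s (𝟙 x) := fun y =>
  s.syl.hom.as.naturality (𝟙 y)

theorem central_comp {x x' x'' : L} {s : HalfSyllepsis x} {s' : HalfSyllepsis x'}
    {s'' : HalfSyllepsis x''} {f : x ⟶ x'} {g : x' ⟶ x''} (hf : central s s' f)
    (hg : central s' s'' g) : central s s'' (f ≫ g) := by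
  rw [central_iff] at *
  exact fun y => ((hf y).comp (hg y)).iso (Iso.prod (Iso.refl (f ≫ g)) (λ_ (𝟙 y)))

instance : CategoryStruct (SyllepticCentre L) where
  Hom X Y := (central X.half Y.half).FullSubcategory
  id X := ⟨𝟙 X.obj, central_id X.half⟩
  comp f g := ⟨f.obj ≫ g.obj, central_comp f.property g.property⟩

/-- The sylleptic centre: its 2-morphisms are those of `L`. -/
instance : Bicategory (SyllepticCentre L) where
  homCategory X Y := inferInstanceAs (Category (central X.half Y.half).FullSubcategory)
  whiskerLeft f _ _ η := ObjectProperty.homMk (f.obj ◁ η.hom)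
  whiskerRight η h := ObjectProperty.homMk (η.hom ▷ h.obj)
  associator f g h := ObjectProperty.isoMk _ (α_ f.obj g.obj h.obj)
  leftUnitor f := ObjectProperty.isoMk _ (λ_ f.obj)
  rightUnitor f := ObjectProperty.isoMk _ (ρ_ f.obj)
  whiskerLeft_id _ _ := ObjectProperty.hom_ext _ (Bicategory.whiskerLeft_id _ _)
  whiskerLeft_comp _ _ _ _ _ _ := ObjectProperty.hom_ext _ (Bicategory.whiskerLeft_comp _ _ _)
  id_whiskerLeft _ := ObjectProperty.hom_ext _ (Bicategory.id_whiskerLeft _)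
  comp_whiskerLeft _ _ _ _ _ := ObjectProperty.hom_ext _ (Bicategory.comp_whiskerLeft _ _ _)
  id_whiskerRight _ _ := ObjectProperty.hom_ext _ (Bicategory.id_whiskerRight _ _)
  comp_whiskerRight _ _ _ := ObjectProperty.hom_ext _ (Bicategory.comp_whiskerRight _ _ _)
  whiskerRight_id _ := ObjectProperty.hom_ext _ (Bicategory.whiskerRight_id _)
  whiskerRight_comp _ _ _ := ObjectProperty.hom_ext _ (Bicategory.whiskerRight_comp _ _ _)
  whisker_assoc _ _ _ _ _ := ObjectProperty.hom_ext _ (Bicategory.whisker_assoc _ _ _)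
  whisker_exchange _ _ := ObjectProperty.hom_ext _ (Bicategory.whisker_exchange _ _)
  pentagon _ _ _ _ := ObjectProperty.hom_ext _ (Bicategory.pentagon _ _ _ _)
  triangle _ _ := ObjectProperty.hom_ext _ (Bicategory.triangle _ _)

/-- The forgetful functor from the sylleptic centre, on categories of 1-morphisms. -/
def forgetHom (X Y : SyllepticCentre L) : (X ⟶ Y) ⥤ (X.obj ⟶ Y.obj) := (central X.half Y.half).ι

end

/-! ### Fusion bicategories -/

open Limits

/-- A `ℂ`-linear bicategory: the 2-morphisms form complex vector spaces and all compositions are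
bilinear. -/
class LinearBicategory (L : Type u) [Bicategory.{w, v} L] where
  preadditive (x y : L) : Preadditive (x ⟶ y)
  linear (x y : L) : Linear ℂ (x ⟶ y)
  whiskerLeft_add {x y z : L} (f : x ⟶ y) {g h : y ⟶ z} (η θ : g ⟶ h) :
    f ◁ (η + θ) = f ◁ η + f ◁ θ
  whiskerLeft_smul {x y z : L} (f : x ⟶ y) {g h : y ⟶ z} (c : ℂ) (η : g ⟶ h) :
    f ◁ (c • η) = c • f ◁ η
  add_whiskerRight {x y z : L} {f g : x ⟶ y} (η θ : f ⟶ g) (h : y ⟶ z) :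
    (η + θ) ▷ h = η ▷ h + θ ▷ h
  smul_whiskerRight {x y z : L} {f g : x ⟶ y} (c : ℂ) (η : f ⟶ g) (h : y ⟶ z) :
    (c • η) ▷ h = c • η ▷ h

attribute [reducible, instance] LinearBicategory.preadditive LinearBicategory.linear

/-- A finite semisimple `ℂ`-linear category. -/
structure IsFiniteSemisimple (C : Type u₁) [Category.{v₁} C] [Preadditive C] [Linear ℂ C] :
    Prop where
  hasFiniteBiproducts : HasFiniteBiproducts C
  simples : ∃ (n : ℕ) (S : Fin n → C),
    (∀ i, Module.finrank ℂ (S i ⟶ S i) = 1) ∧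
    (∀ i j, i ≠ j → Subsingleton (S i ⟶ S j)) ∧
    ∀ A : C, ∃ (m : ℕ) (k : Fin m → Fin n) (b : Bicone fun j => S (k j)),
      Nonempty b.IsBilimit ∧ Nonempty (b.pt ≅ A)

section

variable [LinearBicategory L]

/-- An object `z` of a linear bicategory is zero. -/
def IsZeroObject (z : L) : Prop := IsZero (𝟙 z)

/-- The object `s` is a direct sum of `x` and `y`. -/
def IsDirectSum (x y s : L) : Prop :=
  ∃ (i₁ : x ⟶ s) (p₁ : s ⟶ x) (i₂ : y ⟶ s) (p₂ : s ⟶ y),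
    Nonempty (i₁ ≫ p₁ ≅ 𝟙 x) ∧ Nonempty (i₂ ≫ p₂ ≅ 𝟙 y) ∧ IsZero (i₁ ≫ p₂) ∧
    IsZero (i₂ ≫ p₁) ∧ ∃ b : BinaryBicone (p₁ ≫ i₁) (p₂ ≫ i₂),
      Nonempty b.IsBilimit ∧ Nonempty (b.pt ≅ 𝟙 s)

/-- A simple object: its identity 1-morphism is simple. -/
def IsSimpleObject (x : L) : Prop := Module.finrank ℂ (𝟙 x ⟶ 𝟙 x) = 1

end

/-- A monad `t` on `x` whose multiplication has a section of bimodules. -/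
structure SeparableMonad (x : L) where
  t : x ⟶ x
  m : t ≫ t ⟶ t
  u : 𝟙 x ⟶ t
  assoc : m ▷ t ≫ m = (α_ t t t).hom ≫ t ◁ m ≫ m
  unit_left : u ▷ t ≫ m = (λ_ t).hom
  unit_right : t ◁ u ≫ m = (ρ_ t).hom
  s : t ⟶ t ≫ t
  s_m : s ≫ m = 𝟙 t
  s_left : t ◁ s ≫ (α_ t t t).inv ≫ m ▷ t = m ≫ s
  s_right : s ▷ t ≫ (α_ t t t).hom ≫ t ◁ m = m ≫ s

/-- A separable monad splits if it is the monad of an adjunction whose counit has a section. -/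
def SeparableMonad.Splits {x : L} (M : SeparableMonad x) : Prop :=
  ∃ (y : L) (f : x ⟶ y) (g : y ⟶ x) (adj : Bicategory.Adjunction f g) (φ : f ≫ g ≅ M.t)
    (σ : 𝟙 y ⟶ g ≫ f), σ ≫ adj.counit = 𝟙 (𝟙 y) ∧ adj.unit ≫ φ.hom = M.u ∧
      φ.hom ▷ (f ≫ g) ≫ M.t ◁ φ.hom ≫ M.m =
        (𝟙 _ ⊗≫ f ◁ adj.counit ▷ g ⊗≫ 𝟙 (f ≫ g)) ≫ φ.hom

/-- A finite semisimple bicategory. -/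
structure IsFiniteSemisimpleBicategory (L : Type u) [Bicategory.{w, v} L] [LinearBicategory L] :
    Prop where
  hom (x y : L) : IsFiniteSemisimple (x ⟶ y)
  left_adjoint {x y : L} (f : x ⟶ y) : ∃ g : y ⟶ x, Nonempty (Bicategory.Adjunction g f)
  right_adjoint {x y : L} (f : x ⟶ y) : ∃ g : y ⟶ x, Nonempty (Bicategory.Adjunction f g)
  zero : ∃ z : L, IsZeroObject z
  sum (x y : L) : ∃ s : L, IsDirectSum x y s
  splits {x : L} (M : SeparableMonad x) : M.Splits
  simples : ∃ (n : ℕ) (S : Fin n → L), ∀ x : L, IsSimpleObject x → ∃ i, Nonempty (x ≌ S i)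

section

variable [MonoidalBicategory L]

/-- The objects `x` and `y` are dual, with coevaluation `I ⟶ x ⊗ y` and evaluation `y ⊗ x ⟶ I`. -/
def IsDual (x y : L) : Prop :=
  ∃ (coev : unit L ⟶ x ⊠ y) (ev : y ⊠ x ⟶ unit L),
    Nonempty ((TensorData.leftUnit (L := L)).inv.app x ≫ coev ▹ x ≫ as x y x ≫ x ◃ ev ≫ ru x ≅
      𝟙 x) ∧
    Nonempty ((TensorData.rightUnit (L := L)).inv.app y ≫ y ◃ coev ≫ as' y x y ≫ ev ▹ y ≫ lu y ≅
      𝟙 y)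

end

/-- A fusion bicategory: a finite semisimple monoidal bicategory with bilinear tensor product,
with left and right duals for objects, and with simple unit object. -/
structure IsFusion (L : Type u) [Bicategory.{w, v} L] [LinearBicategory L]
    [MonoidalBicategory L] : Prop extends IsFiniteSemisimpleBicategory L where
  add_left {x x' y y' : L} {f f' : x ⟶ x'} {g g' : y ⟶ y'} (α α' : f ⟶ f') (β : g ⟶ g') :
    tm₂ TensorData.T (α + α') β = tm₂ TensorData.T α β + tm₂ TensorData.T α' β
  smul_left {x x' y y' : L} {f f' : x ⟶ x'} {g g' : y ⟶ y'} (c : ℂ) (α : f ⟶ f') (β : g ⟶ g') :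
    tm₂ TensorData.T (c • α) β = c • tm₂ TensorData.T α β
  add_right {x x' y y' : L} {f f' : x ⟶ x'} {g g' : y ⟶ y'} (α : f ⟶ f') (β β' : g ⟶ g') :
    tm₂ TensorData.T α (β + β') = tm₂ TensorData.T α β + tm₂ TensorData.T α β'
  smul_right {x x' y y' : L} {f f' : x ⟶ x'} {g g' : y ⟶ y'} (c : ℂ) (α : f ⟶ f') (β : g ⟶ g') :
    tm₂ TensorData.T α (c • β) = c • tm₂ TensorData.T α β
  right_dual (x : L) : ∃ y, IsDual x y
  left_dual (y : L) : ∃ x, IsDual x y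
  unit_simple : IsSimpleObject (unit L)

/-! ### Superbicategories

A bicategory enriched over super vector spaces, with all parity shifts, is given in terms of its
even 2-morphisms and of the parity shift `par x : x ⟶ x`: an odd 2-morphism `f ⟶ g` is an even
2-morphism `f ⟶ par ≫ g`. -/

section

variable [MonoidalBicategory L]

/-- A strong transformation of the identity, at `F`. -/
def atF (p : Pseudofunctor.id L ⟶ Pseudofunctor.id L) (F : X ⥤ᵖ L) : F ⟶ F where
  app x := p.app (F.obj x)
  naturality f := (precomp F p).naturality f
  naturality_naturality κ := (precomp F p).naturality_naturality κ
  naturality_id x := by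
    rw [id_mapId]
    exact (precomp F p).naturality_id x
  naturality_comp f g := by
    rw [id_mapComp]
    exact (precomp F p).naturality_comp f g

/-- The parity shifts of a superbicategory, and their behaviour with respect to the tensor
product. -/
class ParityData (L : Type u) [Bicategory.{w, v} L] [MonoidalBicategory L] where
  parity : Pseudofunctor.id L ⟶ Pseudofunctor.id L
  square : parity ≫ parity ≅ 𝟙 (Pseudofunctor.id L)
  left : tnR (atF parity (proj₁ L L)) (proj₂ L L) ≅ atF parity (tn (proj₁ L L) (proj₂ L L))
  right : tnL (proj₁ L L) (atF parity (proj₂ L L)) ≅ atF parity (tn (proj₁ L L) (proj₂ L L))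

variable [ParityData L]

/-- The parity shift of `x`. -/
abbrev par (x : L) : x ⟶ x := (ParityData.parity (L := L)).app x

/-- The parity shift commutes with all 1-morphisms. -/
def parNat {x y : L} (f : x ⟶ y) : f ≫ par y ≅ par x ≫ f :=
  (ParityData.parity (L := L)).naturality f

def parSq (x : L) : par x ≫ par x ≅ 𝟙 x := isoApp (ParityData.square (L := L)) x

def parL (x y : L) : par x ▹ y ≅ par (x ⊠ y) := isoApp (ParityData.left (L := L)) (x, y)

def parR (x y : L) : x ◃ par y ≅ par (x ⊠ y) := isoApp (ParityData.right (L := L)) (x, y)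

end

/-- A braided monoidal superbicategory. -/
class Superbicategory (L : Type u) [Bicategory.{w, v} L] [LinearBicategory L]
    [MonoidalBicategory L] [BraidedBicategory L] extends ParityData L where
  odd_odd (x : L) : (parNat (par x)).hom = -𝟙 (par x ≫ par x)
  square_left (x y : L) :
    (wrComp (par x) (par x) y).hom ≫ (parL x y).hom ▷ (par x ▹ y) ≫
        par (x ⊠ y) ◁ (parL x y).hom ≫ (parSq (x ⊠ y)).hom =
      wr₂ (parSq x).hom y ≫ (tId x y).hom
  square_right (x y : L) :
    (wlComp x (par y) (par y)).hom ≫ (parR x y).hom ▷ (x ◃ par y) ≫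
        par (x ⊠ y) ◁ (parR x y).hom ≫ (parSq (x ⊠ y)).hom =
      wl₂ x (parSq y).hom ≫ (tId x y).hom
  assoc₁ (x y z : L) :
    (asNat₁ (par x) y z).hom ≫ as x y z ◁ (parL x (y ⊠ z)).hom =
      (wr₂ (parL x y).hom z ≫ (parL (x ⊠ y) z).hom) ▷ as x y z ≫ (parNat (as x y z)).inv
  assoc₂ (x y z : L) :
    (asNat₂ x (par y) z).hom ≫ as x y z ◁ (wl₂ x (parL y z).hom ≫ (parR x (y ⊠ z)).hom) =
      (wr₂ (parR x y).hom z ≫ (parL (x ⊠ y) z).hom) ▷ as x y z ≫ (parNat (as x y z)).inv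
  assoc₃ (x y z : L) :
    (asNat₃ x y (par z)).hom ≫ as x y z ◁ (wl₂ x (parR y z).hom ≫ (parR x (y ⊠ z)).hom) =
      (parR (x ⊠ y) z).hom ▷ as x y z ≫ (parNat (as x y z)).inv
  leftUnit (x : L) :
    (luNat (par x)).hom = (parR (unit L) x).hom ▷ lu x ≫ (parNat (lu x)).inv
  rightUnit (x : L) :
    (ruNat (par x)).hom = (parL x (unit L)).hom ▷ ru x ≫ (parNat (ru x)).inv
  braid₁ (x y : L) :
    (brNat₁ (par x) y).hom ≫ br x y ◁ (parR y x).hom =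
      (parL x y).hom ▷ br x y ≫ (parNat (br x y)).inv
  braid₂ (x y : L) :
    (brNat₂ x (par y)).hom ≫ br x y ◁ (parL y x).hom =
      (parR x y).hom ▷ br x y ≫ (parNat (br x y)).inv

/-! ### Lines -/

/-- A monoidal `ℂ`-linear category is equivalent to the category of finite-dimensional vector
spaces. -/
def IsVec (C : Type u₁) [Category.{v₁} C] [Preadditive C] [Linear ℂ C] [MonoidalCategory C] :
    Prop :=
  ∃ F : C ⥤ FGModuleCat.{0} ℂ, F.IsEquivalence ∧ F.Additive ∧ F.Linear ℂ ∧ Nonempty F.Monoidal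

/-- A monoidal `ℂ`-linear category with an object `p` is equivalent to the category of
finite-dimensional super vector spaces, with `p` corresponding to an odd line.
A super vector space is given as a vector space with an involution, the parity operator. -/
def IsSVec (C : Type u₁) [Category.{v₁} C] [Preadditive C] [Linear ℂ C] [MonoidalCategory C]
    (p : C) : Prop :=
  ∃ F : C ⥤ FDRep.{0} ℂ (Multiplicative (ZMod 2)),
    F.IsEquivalence ∧ F.Additive ∧ F.Linear ℂ ∧ Nonempty F.Monoidal ∧
      Module.finrank ℂ (F.obj p) = 1 ∧
      ∀ a : F.obj p, (F.obj p).ρ (Multiplicative.ofAdd 1) a = -a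

section

variable [LinearBicategory L] [MonoidalBicategory L]

/-- A bosonic fusion bicategory is strongly fusion if the endomorphisms of its unit object form
the category of vector spaces. -/
structure IsStronglyFusion (L : Type u) [Bicategory.{w, v} L] [LinearBicategory L]
    [MonoidalBicategory L] : Prop extends IsFusion L where
  lines : IsVec (unit L ⟶ unit L)

/-- A super fusion bicategory is strongly fusion if the endomorphisms of its unit object form the
category of super vector spaces. -/
structure IsStronglySuperFusion (L : Type u) [Bicategory.{w, v} L] [LinearBicategory L]
    [MonoidalBicategory L] [BraidedBicategory L] [Superbicategory L] : Prop extends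
    IsFusion L where
  lines : IsSVec (unit L ⟶ unit L) (par (unit L))

variable [BraidedBicategory L]

instance (X Y : SyllepticCentre L) : Preadditive (X ⟶ Y) :=
  inferInstanceAs (Preadditive (central X.half Y.half).FullSubcategory)

instance (X Y : SyllepticCentre L) : Linear ℂ (X ⟶ Y) :=
  inferInstanceAs (Linear ℂ (central X.half Y.half).FullSubcategory)

/-- The unit object, with a half-syllepsis. -/
def unitWith (s : HalfSyllepsis (unit L)) : SyllepticCentre L := ⟨unit L, s⟩

end

end Tricat

open Tricat

/-! The prism condition on `f` says that the components of the half-syllepses form a naturality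
square at each 1-morphism `(f, 𝟙 y)`. Both sides of this equation are compatible with 2-morphisms in
the variable `f`. Hence, if an endomorphism `κ` of `f` factors through some `g` satisfying the
condition, the two sides for `f` agree after precomposition with `κ ⊗ y` (`Square.whisker`). Since
the tensor product and whiskering are bilinear, the `κ` with this property form an additive group.
When `𝟙 f` is a sum of endomorphisms factoring through central 1-morphisms, `f` is therefore central
(`central_of_factoring`): central 1-morphisms are closed under sums and summands.

It remains to find enough central endomorphisms of the unit object. The identity is central because
a half-syllepsis is natural in `y`. In `Vec` the identity of every object is a sum of maps through
the monoidal unit, so the bosonic case follows.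

In `SVec` the odd line is needed as well, so one must know that the parity shift is central
(`central_par`). Compatibility of the parity shift with the braiding identifies the naturality cell
of the braiding at a parity shift with the cell of the parity transformation at the braiding. The
same then holds for the inverse braiding (`Shifts.inv`). The prism for the parity shift thus becomes
naturality of the parity transformation with respect to the 2-morphism `v y`, which is automatic
(`Shifts.square`).

Once every endomorphism of the unit object is central, the forgetful functor is the inclusion of a
full subcategory containing all objects. It is linear and strictly compatible with composition, so
composing it with the given equivalence from `End 𝟙` to `Vec` or `SVec` yields the result. -/

namespace Tricat

/-! ### Naturality squares and transformations of the identity -/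

section Squares

variable {B : Type u₁} [Bicategory.{w₁, v₁} B] {L : Type u} [Bicategory.{w, v} L] {F G : B ⥤ᵖ L}

/-- Both composites around a square are natural in the 1-morphism at which it is taken, so `α`
slides through them and replaces `h` by `k`, where the square is known. This is the form of
`Square.iso` suited to direct summands: `π` and `α` need not be invertible. -/
theorem Square.whisker {η θ : F ⟶ G} {a b : B} {ma : η.app a ⟶ θ.app a}
    {mb : η.app b ⟶ θ.app b} {h k : a ⟶ b} (hk : Square η θ ma mb k) (π : h ⟶ k) (α : k ⟶ h) :
    F.map₂ (π ≫ α) ▷ η.app b ≫ F.map h ◁ mb ≫ (θ.naturality h).hom =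
      F.map₂ (π ≫ α) ▷ η.app b ≫ (η.naturality h).hom ≫ ma ▷ G.map h := by
  have e₁ := η.naturality_naturality α
  have e₂ := θ.naturality_naturality α
  unfold Square at hk
  rw [F.map₂_comp, comp_whiskerRight, assoc, assoc]
  congr 1
  rw [← whisker_exchange_assoc, e₂, reassoc_of% hk, reassoc_of% e₁, whisker_exchange]

/-- Whiskering with an equivalence is faithful. -/
theorem whiskerRight_cancel {x y z : L} {f g : x ⟶ y} {N N' : f ⟶ g} {h : y ⟶ z} {h' : z ⟶ y}
    (u : 𝟙 y ≅ h ≫ h') (e : N ▷ h = N' ▷ h) : N = N' := by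
  have e₁ : N ▷ (h ≫ h') = N' ▷ (h ≫ h') := by
    rw [whiskerRight_comp, whiskerRight_comp, e]
  -- Conjugation by the unit `u` turns whiskering with `h ≫ h'` into whiskering with an identity.
  have e₂ : N ▷ 𝟙 y = N' ▷ 𝟙 y := by
    rw [← cancel_mono (g ◁ u.hom), ← whisker_exchange, ← whisker_exchange, e₁]
  simpa using e₂

/-- The components of a transformation of the identity. -/
def comp₁ (p : Pseudofunctor.id L ⟶ Pseudofunctor.id L) (x : L) : x ⟶ x := p.app x

/-- The naturality of a transformation of the identity. -/
def comp₂ (p : Pseudofunctor.id L ⟶ Pseudofunctor.id L) {x y : L} (f : x ⟶ y) :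
    f ≫ comp₁ p y ≅ comp₁ p x ≫ f := p.naturality f

/-- This and the next two lemmas are the axioms of a strong transformation rewritten for the inverse
cells, with the structure cells of the identity pseudofunctor, which are identities, removed. -/
theorem comp₂_naturality (p : Pseudofunctor.id L ⟶ Pseudofunctor.id L) {x y : L}
    {f g : x ⟶ y} (m : f ⟶ g) :
    comp₁ p x ◁ m ≫ (comp₂ p g).inv = (comp₂ p f).inv ≫ m ▷ comp₁ p y := by
  have e : m ▷ comp₁ p y ≫ (comp₂ p g).hom = (comp₂ p f).hom ≫ comp₁ p x ◁ m :=
    p.naturality_naturality m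
  rw [Iso.comp_inv_eq, assoc, Iso.eq_inv_comp]
  exact e.symm

theorem comp₂_id (p : Pseudofunctor.id L ⟶ Pseudofunctor.id L) (x : L) :
    (comp₂ p (𝟙 x)).inv = (ρ_ (comp₁ p x)).hom ≫ (λ_ (comp₁ p x)).inv := by
  have e : (comp₂ p (𝟙 x)).hom ≫ comp₁ p x ◁ 𝟙 (𝟙 x) =
    𝟙 (𝟙 x) ▷ comp₁ p x ≫ (λ_ _).hom ≫ (ρ_ _).inv := p.naturality_id x
  rw [Bicategory.whiskerLeft_id, id_whiskerRight, comp_id, id_comp] at e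
  rw [← cancel_epi (comp₂ p (𝟙 x)).hom, Iso.hom_inv_id, e]
  simp

theorem comp₂_comp (p : Pseudofunctor.id L ⟶ Pseudofunctor.id L) {x y z : L}
    (f : x ⟶ y) (g : y ⟶ z) :
    (comp₂ p (f ≫ g)).inv = (α_ _ _ _).inv ≫ (comp₂ p f).inv ▷ g ≫ (α_ _ _ _).hom ≫
      f ◁ (comp₂ p g).inv ≫ (α_ _ _ _).inv := by
  have e : (comp₂ p (f ≫ g)).hom ≫ comp₁ p x ◁ 𝟙 (f ≫ g) =
      𝟙 (f ≫ g) ▷ comp₁ p z ≫ (α_ _ _ _).hom ≫ f ◁ (comp₂ p g).hom ≫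
        (α_ _ _ _).inv ≫ (comp₂ p f).hom ▷ g ≫ (α_ _ _ _).hom :=
    p.naturality_comp f g
  rw [Bicategory.whiskerLeft_id, id_whiskerRight, comp_id, id_comp] at e
  rw [← cancel_epi (comp₂ p (f ≫ g)).hom, Iso.hom_inv_id, e]
  simp

/-- Given identifications `φ` and `ψ` of `F k` and `G k` with the components of a transformation
`p` of the identity, the naturality of `η` at `k` is the one of `p` at the component of `η`. -/
def Shifts (p : Pseudofunctor.id L ⟶ Pseudofunctor.id L) (η : F ⟶ G) {a : B} {k : a ⟶ a}
    (φ : F.map k ≅ comp₁ p (F.obj a)) (ψ : G.map k ≅ comp₁ p (G.obj a)) : Prop :=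
  (η.naturality k).hom ≫ η.app a ◁ ψ.hom = φ.hom ▷ η.app a ≫ (comp₂ p (η.app a)).inv

/-- After substituting the cells of `p` for the naturality cells of `η` and `θ` at `k`, the square
is the naturality of `p` with respect to the 2-morphism `m`. For this reason `m` can be arbitrary.
-/
theorem Shifts.square {p : Pseudofunctor.id L ⟶ Pseudofunctor.id L} {η θ : F ⟶ G} {a : B}
    {k : a ⟶ a} {φ : F.map k ≅ comp₁ p (F.obj a)} {ψ : G.map k ≅ comp₁ p (G.obj a)}
    (hη : Shifts p η φ ψ) (hθ : Shifts p θ φ ψ) (m : η.app a ⟶ θ.app a) :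
    Square η θ m m k := by
  unfold Shifts Square at *
  rw [← cancel_mono (θ.app a ◁ ψ.hom), assoc, hθ, assoc, ← whisker_exchange, reassoc_of% hη,
    whisker_exchange_assoc, comp₂_naturality]

/-- The cell of an inverse equivalence is determined by that of the equivalence: the counit is a
modification, so pasting the two cells gives the trivial cell. The cells of `p` at `i` and `j` paste
to a trivial cell in the same way, by the composition and identity axioms of `p`. -/
theorem Shifts.inv {p : Pseudofunctor.id L ⟶ Pseudofunctor.id L} (e : F ≌ G) {a : B}
    {k : a ⟶ a} {φ : F.map k ≅ comp₁ p (F.obj a)} {ψ : G.map k ≅ comp₁ p (G.obj a)}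
    (h : Shifts p e.hom φ ψ) : Shifts p e.inv ψ φ := by
  let i : G.obj a ⟶ F.obj a := e.inv.app a
  let j : F.obj a ⟶ G.obj a := e.hom.app a
  let c : i ≫ j ≅ 𝟙 (G.obj a) := isoApp e.counit a
  let N : G.map k ≫ i ⟶ i ≫ F.map k := (e.inv.naturality k).hom
  let M : F.map k ≫ j ⟶ j ≫ G.map k := (e.hom.naturality k).hom
  -- The square of the counit at `k`: the pasting of `N` and `M` is trivial up to `c`.
  have hc : G.map k ◁ c.hom ≫ (ρ_ _).hom ≫ (λ_ _).inv =
      ((α_ _ _ _).inv ≫ N ▷ j ≫ (α_ _ _ _).hom ≫ i ◁ M ≫ (α_ _ _ _).inv) ≫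
        c.hom ▷ G.map k :=
    e.counit.hom.as.naturality k
  have hp := comp₂_comp p i j
  have h1 := comp₂_id p (G.obj a)
  have hn := comp₂_naturality p c.hom
  have hM : M = φ.hom ▷ j ≫ (comp₂ p j).inv ≫ j ◁ ψ.inv := by
    unfold Shifts at h
    rw [← cancel_mono (j ◁ ψ.hom)]
    simpa using h
  suffices hN : N = ψ.hom ▷ i ≫ (comp₂ p i).inv ≫ i ◁ φ.inv by
    change N ≫ i ◁ φ.hom = ψ.hom ▷ i ≫ (comp₂ p i).inv
    rw [hN]
    simp
  -- `j` is an equivalence, so the two candidates for the cell of `e.inv` may be compared after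
  -- whiskering with it.
  refine whiskerRight_cancel (isoApp e.unit a) (?_ : _ ▷ j = _ ▷ j)
  clear_value i j c N M
  -- The proposed formula for `N` satisfies the equation that `hc` gives for `N`. Uniqueness follows
  -- because `M` and `c` are invertible.
  have hcomp : ((ψ.hom ▷ i ≫ (comp₂ p i).inv ≫ i ◁ φ.inv) ▷ j ≫ (α_ _ _ _).hom ≫ i ◁ M ≫
      (α_ _ _ _).inv) ≫ c.hom ▷ G.map k =
        (α_ _ _ _).hom ≫ G.map k ◁ c.hom ≫ (ρ_ _).hom ≫ (λ_ _).inv := by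
    have e₁ : (comp₂ p i).inv ▷ j ≫ (α_ _ _ _).hom ≫ i ◁ (comp₂ p j).inv ≫ (α_ _ _ _).inv =
        (α_ _ _ _).hom ≫ (comp₂ p (i ≫ j)).inv := by
      rw [hp, Iso.hom_inv_id_assoc]
    calc _ = (ψ.hom ▷ i) ▷ j ≫ ((comp₂ p i).inv ▷ j ≫ (α_ _ _ _).hom ≫ i ◁ (comp₂ p j).inv ≫
          (α_ _ _ _).inv) ≫ (i ≫ j) ◁ ψ.inv ≫ c.hom ▷ G.map k := by
          rw [hM]
          simp
      _ = (α_ _ _ _).hom ≫ ψ.hom ▷ (i ≫ j) ≫ ((comp₂ p (i ≫ j)).inv ≫ c.hom ▷ comp₁ p _) ≫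
          𝟙 _ ◁ ψ.inv := by
          rw [e₁, whisker_exchange]
          simp
      _ = _ := by
          -- Naturality of `p` in the counit moves its cell from `i ≫ j` to the identity, where it
          -- consists of unitors.
          rw [← hn, h1, assoc, ← whisker_exchange_assoc]
          simp
  have hM' : IsIso M := by
    rw [hM]
    infer_instance
  rw [← cancel_mono ((α_ _ _ _).hom ≫ i ◁ M ≫ (α_ _ _ _).inv ≫ c.hom ▷ G.map k)]
  rw [← cancel_epi (α_ _ _ _).inv]
  simp only [assoc] at hcomp hc ⊢
  rw [hcomp, ← hc, Iso.inv_hom_id_assoc]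

end Squares
end Tricat

namespace Tricat

/-! ### Identities that are sums of maps through given objects -/

section Summands

variable {C : Type u₁} [Category.{v₁} C] [Preadditive C]
  {D : Type u₂} [Category.{v₂} D] [Preadditive D]

/-- The endomorphisms of `X` which are sums of endomorphisms factoring through objects of `P`. -/
def factoring (P : ObjectProperty C) (X : C) : AddSubgroup (X ⟶ X) :=
  AddSubgroup.closure {κ | ∃ (Y : C) (_ : P Y) (π : X ⟶ Y) (α : Y ⟶ X), π ≫ α = κ}

theorem comp_mem_factoring {P : ObjectProperty C} {X Y : C} (hY : P Y) (π : X ⟶ Y) (α : Y ⟶ X) :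
    π ≫ α ∈ factoring P X :=
  AddSubgroup.subset_closure ⟨Y, hY, π, α, rfl⟩

/-- A fully faithful additive functor reflects the factorization of identities. -/
theorem id_mem_factoring_of_map (F : C ⥤ D) [F.Full] [F.Faithful] [F.Additive]
    {P : ObjectProperty C} {Q : ObjectProperty D}
    (hQ : ∀ Z, Q Z → ∃ Y, P Y ∧ Nonempty (F.obj Y ≅ Z)) {X : C}
    (h : 𝟙 (F.obj X) ∈ factoring Q (F.obj X)) : 𝟙 X ∈ factoring P X := by
  -- Taking preimages is additive, so only generators matter. There the isomorphism with an object
  -- in the image of `F`, inserted in the middle, makes both factors lift.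
  have key : ∀ κ ∈ factoring Q (F.obj X), F.preimage κ ∈ factoring P X := by
    intro κ hκ
    induction hκ using AddSubgroup.closure_induction with
    | mem κ hκ =>
      obtain ⟨Z, hZ, π, α, rfl⟩ := hκ
      obtain ⟨Y, hY, ⟨e⟩⟩ := hQ Z hZ
      have e' : F.preimage (π ≫ α) = F.preimage (π ≫ e.inv) ≫ F.preimage (e.hom ≫ α) :=
        F.map_injective (by simp)
      rw [e']
      exact comp_mem_factoring hY _ _
    | zero =>
      rw [show F.preimage (0 : F.obj X ⟶ F.obj X) = 0 from F.map_injective (by simp)]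
      exact zero_mem _
    | add κ κ' _ _ h h' =>
      rw [show F.preimage (κ + κ') = F.preimage κ + F.preimage κ' from
        F.map_injective (by simp [F.map_add])]
      exact add_mem h h'
    | neg κ _ h =>
      rw [show F.preimage (-κ) = -F.preimage κ from F.map_injective (by simp [F.map_neg])]
      exact neg_mem h
  simpa using key _ h

end Summands

/-! ### Vector spaces and super vector spaces -/

section Representations

open MonoidalCategory

/-- A basis and its dual basis write the identity as a sum of rank one maps, and each of them
factors through `ℂ`, the monoidal unit. -/
theorem id_mem_factoring_unit (V : FGModuleCat.{0} ℂ) :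
    𝟙 V ∈ factoring (fun Z => Z = 𝟙_ (FGModuleCat.{0} ℂ)) V := by
  let b := Module.finBasis ℂ V
  have e : 𝟙 V = ∑ i, (FGModuleCat.ofHom (b.coord i) : V ⟶ FGModuleCat.of ℂ ℂ) ≫
      (FGModuleCat.ofHom (LinearMap.toSpanSingleton ℂ V (b i)) : FGModuleCat.of ℂ ℂ ⟶ V) := by
    refine FGModuleCat.hom_ext (LinearMap.ext fun x => ?_)
    -- Evaluation at `x` respects zero and sums definitionally, hence the induction over finite sets
    -- closed by `rfl`.
    have hsum : ∀ t : Finset (Fin (Module.finrank ℂ V)), (∑ i ∈ t,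
        (FGModuleCat.ofHom (b.coord i) : V ⟶ FGModuleCat.of ℂ ℂ) ≫
          (FGModuleCat.ofHom (LinearMap.toSpanSingleton ℂ V (b i)) :
            FGModuleCat.of ℂ ℂ ⟶ V)).hom.hom x = ∑ i ∈ t, b.repr x i • b i := by
      intro t
      induction t using Finset.induction_on with
      | empty => rfl
      | insert i t hi ih =>
        rw [Finset.sum_insert hi, Finset.sum_insert hi, ← ih]
        rfl
    rw [hsum, b.sum_repr]
    rfl
  rw [e]
  exact sum_mem fun i _ => comp_mem_factoring (P := fun Z => Z = 𝟙_ (FGModuleCat.{0} ℂ))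
    (Y := 𝟙_ (FGModuleCat.{0} ℂ)) rfl _ _

/-- A morphism of representations of `ℤ/2`, from a linear map commuting with the involutions. -/
def superHom {V W : FDRep.{0} ℂ (Multiplicative (ZMod 2))} (f : V →ₗ[ℂ] W)
    (hf : ∀ x, f (V.ρ (.ofAdd 1) x) = W.ρ (.ofAdd 1) (f x)) : V ⟶ W where
  hom := FGModuleCat.ofHom f
  comm g := by
    ext x
    change f (V.ρ g x) = W.ρ g (f x)
    have hg : g = 1 ∨ g = .ofAdd 1 := by
      revert g; decide
    rcases hg with rfl | rfl
    · simp
    · exact hf x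

/-- The involution splits `V` into eigenspaces for `1` and `-1`. Rank one maps on the first factor
through the trivial representation, and those on the second through the odd line `P`. -/
theorem id_mem_factoring_super (V P : FDRep.{0} ℂ (Multiplicative (ZMod 2)))
    (h : Module.finrank ℂ P = 1) (hP : ∀ a : P, P.ρ (.ofAdd 1) a = -a) :
    𝟙 V ∈ factoring (fun Z => Z = 𝟙_ (FDRep.{0} ℂ (Multiplicative (ZMod 2))) ∨ Z = P) V := by
  let b := Module.finBasis ℂ V
  let ρ : V →ₗ[ℂ] V := V.ρ (.ofAdd 1)
  have hρ : ∀ x, ρ (ρ x) = x := fun x => by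
    change (V.ρ (.ofAdd 1) * V.ρ (.ofAdd 1)) x = x
    rw [← map_mul, show (Multiplicative.ofAdd (1 : ZMod 2)) * .ofAdd 1 = 1 from rfl, map_one]
    rfl
  let φ : P ≃ₗ[ℂ] ℂ := LinearEquiv.ofFinrankEq _ _ (by rw [h, Module.finrank_self])
  -- The two eigenprojections. Using each of them twice, once before taking coordinates and once on
  -- the basis vectors, permits an arbitrary basis of `V` instead of bases of the eigenspaces.
  let even : V →ₗ[ℂ] V := (2⁻¹ : ℂ) • (LinearMap.id + ρ)
  let odd : V →ₗ[ℂ] V := (2⁻¹ : ℂ) • (LinearMap.id - ρ)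
  have even_ρ : ∀ x, even (ρ x) = even x := fun x => by simp [even, hρ, add_comm]
  have ρ_even : ∀ x, ρ (even x) = even x := fun x => by simp [even, hρ, add_comm]
  have odd_ρ : ∀ x, odd (ρ x) = -odd x := fun x => by simp [odd, hρ, ← smul_neg]
  have ρ_odd : ∀ x, ρ (odd x) = -odd x := fun x => by simp [odd, hρ, ← smul_neg]
  have even_add_odd : ∀ x, even (even x) + odd (odd x) = x := fun x => by
    simp only [even, odd, LinearMap.smul_apply, LinearMap.add_apply, LinearMap.sub_apply,
      LinearMap.id_apply, map_smul, map_add, map_sub, hρ]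
    module
  let I := 𝟙_ (FDRep.{0} ℂ (Multiplicative (ZMod 2)))
  let π₀ (i) : V ⟶ I := superHom (V := V) (W := I) (b.coord i ∘ₗ even)
    fun x => congrArg (b.coord i) (even_ρ x)
  let α₀ (i) : I ⟶ V := superHom (V := I) (W := V) (LinearMap.toSpanSingleton ℂ V (even (b i)))
    fun x => by
      change x • even (b i) = ρ (x • even (b i))
      rw [map_smul, ρ_even]
  let π₁ (i) : V ⟶ P := superHom (V := V) (W := P) (φ.symm.toLinearMap ∘ₗ b.coord i ∘ₗ odd)
    fun x => by
      change φ.symm (b.coord i (odd (ρ x))) = _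
      rw [odd_ρ, map_neg, map_neg, hP]
      rfl
  let α₁ (i) : P ⟶ V := superHom (V := P) (W := V)
    (LinearMap.toSpanSingleton ℂ V (odd (b i)) ∘ₗ φ.toLinearMap) fun x => by
      change φ (P.ρ _ x) • odd (b i) = ρ (φ x • odd (b i))
      rw [hP, map_neg, map_smul, ρ_odd, neg_smul, smul_neg]
  have e : 𝟙 V = ∑ i, (π₀ i ≫ α₀ i + π₁ i ≫ α₁ i) := by
    refine Action.Hom.ext (FGModuleCat.hom_ext (LinearMap.ext fun x => ?_))
    have hsum : ∀ t : Finset (Fin (Module.finrank ℂ V)),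
        (∑ i ∈ t, (π₀ i ≫ α₀ i + π₁ i ≫ α₁ i)).hom.hom.hom x =
          ∑ i ∈ t, (b.repr (even x) i • even (b i) + b.repr (odd x) i • odd (b i)) := by
      intro t
      induction t using Finset.induction_on with
      | empty => rfl
      | insert i t hi ih =>
        rw [Finset.sum_insert hi, Finset.sum_insert hi, ← ih]
        -- Inserting `φ` after its inverse exhibits the coefficient as the value of a map passing
        -- through `P`.
        have : φ (φ.symm (b.repr (odd x) i)) = b.repr (odd x) i := φ.apply_symm_apply _
        rw [← this]
        rfl
    rw [hsum, Finset.sum_add_distrib]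
    simp only [← map_smul, ← map_sum, b.sum_repr, even_add_odd]
    rfl
  rw [e]
  exact sum_mem fun i _ => add_mem
    (comp_mem_factoring (P := fun Z => Z = I ∨ Z = P) (Or.inl rfl) _ _)
    (comp_mem_factoring (P := fun Z => Z = I ∨ Z = P) (Or.inr rfl) _ _)

end Representations

/-! ### Central 1-morphisms and the forgetful functor -/

section Centre

variable {L : Type u} [Bicategory.{w, v} L] [MonoidalBicategory L] [BraidedBicategory L]

theorem forgetHom_isEquivalence {X Y : SyllepticCentre L} (h : ∀ f, central X.half Y.half f) :
    (forgetHom X Y).IsEquivalence where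
  faithful := inferInstanceAs (central X.half Y.half).ι.Faithful
  full := inferInstanceAs (central X.half Y.half).ι.Full
  essSurj := ⟨fun f => ⟨⟨f, h f⟩, ⟨Iso.refl _⟩⟩⟩

/-- Identities, composites and coherence cells of the centre lie over those of `L`, so identity
2-morphisms serve as the monoidal structure. -/
instance (X : SyllepticCentre L) : (forgetHom X X).Monoidal :=
  Functor.CoreMonoidal.toMonoidal
    { εIso := Iso.refl _
      μIso _ _ := Iso.refl _
      μIso_hom_natural_left _ _ := (comp_id _).trans (id_comp _).symm
      μIso_hom_natural_right _ _ := (comp_id _).trans (id_comp _).symm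
      associativity f g h := by
        change 𝟙 (f.obj ≫ g.obj) ▷ h.obj ≫ 𝟙 _ ≫ (α_ f.obj g.obj h.obj).hom =
          (α_ f.obj g.obj h.obj).hom ≫ f.obj ◁ 𝟙 (g.obj ≫ h.obj) ≫ 𝟙 _
        simp
      left_unitality f := by
        change (λ_ f.obj).hom = 𝟙 (𝟙 X.obj) ▷ f.obj ≫ 𝟙 _ ≫ (λ_ f.obj).hom
        simp
      right_unitality f := by
        change (ρ_ f.obj).hom = f.obj ◁ 𝟙 (𝟙 X.obj) ≫ 𝟙 _ ≫ (ρ_ f.obj).hom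
        simp }

variable [LinearBicategory L]

/-- The 1-morphisms of the sylleptic centre are closed under sums and summands. -/
theorem central_of_factoring (hL : IsFusion L) {x x' : L} {s : HalfSyllepsis x}
    {s' : HalfSyllepsis x'} {f : x ⟶ x'} (h : 𝟙 f ∈ factoring (central s s') f) :
    central s s' f := by
  rw [central_iff]
  intro y
  -- The prism equation for `f`, precomposed with `κ ⊗ y`. It is additive in `κ`, and `κ = 𝟙 f`
  -- gives the equation itself.
  have hnat : ∀ κ ∈ factoring (central s s') f, wr₂ κ y ▷ br x' y ≫ wr f y ◁ (s'.v y).hom ≫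
      (brNat₂' y f).hom = wr₂ κ y ▷ br x' y ≫ (brNat₁ f y).hom ≫ (s.v y).hom ▷ wl y f := by
    intro κ hκ
    induction hκ using AddSubgroup.closure_induction with
    | mem κ hκ =>
      obtain ⟨g, hg, π, α, rfl⟩ := hκ
      -- Splitting the identity in the second variable turns the pair into a composite of
      -- 2-morphisms of `L × L`, as `Square.whisker` requires.
      have e : wr₂ (π ≫ α) y = tm₂ TensorData.T (π ≫ α) (𝟙 (𝟙 y) ≫ 𝟙 (𝟙 y)) := by
        rw [comp_id]
      rw [e]
      exact Square.whisker ((central_iff s s' g).1 hg y) (h := (f, 𝟙 y)) (π, 𝟙 (𝟙 y)) (α, 𝟙 (𝟙 y))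
    | zero =>
      -- Zero, and the negative below, are treated as the scalar multiples by `0` and `-1`.
      have e : wr₂ (0 : f ⟶ f) y = 0 := by
        simpa using hL.smul_left (0 : ℂ) (0 : f ⟶ f) (𝟙 (𝟙 y))
      have e' : (0 : wr f y ⟶ wr f y) ▷ br x' y = 0 := by
        simpa using LinearBicategory.smul_whiskerRight (0 : ℂ) (0 : wr f y ⟶ wr f y) (br x' y)
      rw [e, e', Limits.zero_comp, Limits.zero_comp]
    | add κ κ' _ _ h h' =>
      have e : wr₂ (κ + κ') y = wr₂ κ y + wr₂ κ' y := hL.add_left κ κ' (𝟙 (𝟙 y))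
      rw [e, LinearBicategory.add_whiskerRight, Preadditive.add_comp, Preadditive.add_comp, h, h']
    | neg κ _ h =>
      have e : wr₂ (-κ) y = (-1 : ℂ) • wr₂ κ y := by
        simpa using hL.smul_left (-1 : ℂ) κ (𝟙 (𝟙 y))
      rw [e, LinearBicategory.smul_whiskerRight, Linear.smul_comp, Linear.smul_comp, h]
  have := hnat _ h
  rw [wr₂, tm₂_id, id_whiskerRight, id_comp, id_comp] at this
  exact this

/-- The braiding and its inverse both carry parity shifts to parity shifts compatibly with the
parity transformation, so any 2-morphism between their components satisfies the prism. -/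
theorem central_par [Superbicategory L] {x : L} (s : HalfSyllepsis x) :
    central s s (par x) := by
  intro y
  have h₁ : Shifts (ParityData.parity (L := L)) (BraidingData.braid (L := L)).hom (a := (x, y))
      (k := (par x, 𝟙 y)) (parL x y) (parR y x) := Superbicategory.braid₁ x y
  -- Taken at `(y, x)`, in the second variable, because the target of `v y` is the inverse of the
  -- braiding of `y` with `x`.
  have h₂ : Shifts (ParityData.parity (L := L)) (BraidingData.braid (L := L)).hom (a := (y, x))
      (k := (𝟙 y, par x)) (parR y x) (parL x y) := Superbicategory.braid₂ y x
  have h₃ := h₂.inv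
  -- The reverse braiding at `(x, y)` is by definition the inverse braiding at `(y, x)`, with the
  -- two variables of its naturality cells exchanged.
  have h₄ : Shifts (ParityData.parity (L := L)) (bRevT (proj₁ L L) (proj₂ L L)) (a := (x, y))
      (k := (par x, 𝟙 y)) (parL x y) (parR y x) := h₃
  exact Shifts.square (η := bT (proj₁ L L) (proj₂ L L)) h₁ h₄ (s.v y).hom

instance (X Y : SyllepticCentre L) : (forgetHom X Y).Additive :=
  inferInstanceAs (central X.half Y.half).ι.Additive

instance (X Y : SyllepticCentre L) : (forgetHom X Y).Linear ℂ :=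
  inferInstanceAs ((central X.half Y.half).ι.Linear ℂ)

theorem isVec_centre {X : SyllepticCentre L} (h : ∀ f, central X.half X.half f)
    (hX : IsVec (X.obj ⟶ X.obj)) : IsVec (X ⟶ X) := by
  obtain ⟨F, _, _, _, ⟨_⟩⟩ := hX
  have := forgetHom_isEquivalence h
  exact ⟨forgetHom X X ⋙ F, inferInstance, inferInstance, inferInstance, ⟨inferInstance⟩⟩

theorem isSVec_centre {X : SyllepticCentre L} (h : ∀ f, central X.half X.half f) (p : X ⟶ X)
    (hX : IsSVec (X.obj ⟶ X.obj) p.obj) : IsSVec (X ⟶ X) p := by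
  obtain ⟨F, _, _, _, ⟨_⟩, h₁, h₂⟩ := hX
  have := forgetHom_isEquivalence h
  exact ⟨forgetHom X X ⋙ F, inferInstance, inferInstance, inferInstance, ⟨inferInstance⟩, h₁, h₂⟩

end Centre

end Tricat

/-! ### Lines over the unit object -/

theorem lemma3 {L : Type u} [Bicategory.{w, v} L] [LinearBicategory L] [MonoidalBicategory L]
    [BraidedBicategory L] :
    (IsStronglyFusion L → ∀ s : HalfSyllepsis (unit L),
      (forgetHom (unitWith s) (unitWith s)).IsEquivalence ∧ IsVec (unitWith s ⟶ unitWith s)) ∧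
    (∀ [Superbicategory L], IsStronglySuperFusion L → ∀ s : HalfSyllepsis (unit L),
      (forgetHom (unitWith s) (unitWith s)).IsEquivalence ∧
        ∃ p : unitWith s ⟶ unitWith s, (forgetHom (unitWith s) (unitWith s)).obj p = par (unit L) ∧
          IsSVec (unitWith s ⟶ unitWith s) p) := by
  refine ⟨fun hL s => ?_, fun hL s => ?_⟩
  · obtain ⟨F, _, _, _, ⟨_⟩⟩ := hL.lines
    have hc : ∀ f, central s s f := fun f => central_of_factoring hL.toIsFusion
      (id_mem_factoring_of_map F (by
        rintro Z rfl
        -- A monoidal functor sends the identity 1-morphism, which is the unit of `End 𝟙`, to the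
        -- unit of `Vec`.
        exact ⟨𝟙 _, central_id s, ⟨(Functor.Monoidal.εIso F).symm⟩⟩)
        (id_mem_factoring_unit (F.obj f)))
    exact ⟨forgetHom_isEquivalence hc, isVec_centre (X := unitWith s) hc hL.lines⟩
  · obtain ⟨F, _, _, _, ⟨_⟩, h₁, h₂⟩ := hL.lines
    have hc : ∀ f, central s s f := fun f => central_of_factoring hL.toIsFusion
      (id_mem_factoring_of_map F (by
        rintro Z (rfl | rfl)
        · exact ⟨𝟙 _, central_id s, ⟨(Functor.Monoidal.εIso F).symm⟩⟩
        -- The odd line is chosen as the image of the parity shift itself, so the required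
        -- isomorphism is the identity.
        · exact ⟨_, central_par s, ⟨Iso.refl _⟩⟩)
        (id_mem_factoring_super (F.obj f) _ h₁ h₂))
    exact ⟨forgetHom_isEquivalence hc, ⟨par (unit L), central_par s⟩, rfl,
      isSVec_centre (X := unitWith s) hc _ hL.lines⟩
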